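/- Let $p$ be a prime. For a finite group $G$ and a Sylow $p$-subgroup $T$ of $G$, let $\mathcal{O}_T(G)$ be the orbit category whose objects are the subgroups $P\le T$ and whose morphisms from $P$ to $Q$ are the $G$-equivariant maps $G/P\to G/Q$; each such map has the form $gP\mapsto gaQ$ for some $a\in G$. For an $\mathbb{F}_p[G]$-module $M$, let $F_M\colon\mathcal{O}_T(G)^{\mathrm{op}}\to\mathsf{Ab}$ be the functor with $F_M(1)=M$ and $F_M(P)=0$ for $P\ne1$, where $\mathrm{Aut}_{\mathcal{O}_T(G)}(1)\cong G$ has the given action on $F_M(1)=M$ (the automorphism $g\mapsto ga$ of $G/1$ induces $m\mapsto am$). Put $$\Lambda^i(G;M)=\varprojlim_{\mathcal{O}_T(G)}{}^{\!i}\,F_M ,$$ the $i$-th right derived functor of the inverse limit functor on contravariant functors from $\mathcal{O}_T(G)$ to abelian groups, evaluated at $F_M$. For an $\mathbb{F}_p[G]$-module $M$, the wreath product $G\wr C_p=G^p\rtimes C_p$ (where $C_p$ is cyclic of order $p$ and permutes the $p$ factors by translation) acts on $M^p$: the subgroup $G^p$ acts coordinatewise and $C_p$ permutes the coordinates. Let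 $\Sigma_{p+1}$ be the symmetric group on $p+1$ letters and let $V\cong(\mathbb{F}_p)^p$ be its natural module over $\mathbb{F}_p$, that is, the $(p+1)$-dimensional permutation module modulo the diagonal (the constant vectors). Let $\Gamma=(\Sigma_{p+1}\wr C_p)\wr C_p$ act on $V^{p^2}=(V^p)^p$ by applying the above construction twice. Then, for every prime $p$ and every choice of the Sylow $p$-subgroup $T$ of $\Gamma$, there is an isomorphism of abelian groups $$\Lambda^3(\Sigma_{p+1}\wr C_p\wr C_p\,;\,V^{p^2})\cong\mathbb{F}_p .$$ -/

import Mathlib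

open CategoryTheory CategoryTheory.Limits

universe u

/-! ### Higher limits -/

section HigherLimits

variable (C : Type u) [SmallCategory C]

instance abPresheafGrothendieck :
    IsGrothendieckAbelian.{u} (Cᵒᵖ ⥤ AddCommGrpCat.{u}) where
  ab5OfSize := ⟨fun _ _ _ => inferInstance⟩

/-- The category of functors `Cᵒᵖ ⥤ Ab` has enough injectives, so that right derived functors
are available. -/
instance abPresheafEnoughInjectives : EnoughInjectives (Cᵒᵖ ⥤ AddCommGrpCat.{u}) :=
  IsGrothendieckAbelian.enoughInjectives.{u}

/-- The inverse limit functor on contravariant functors `Cᵒᵖ ⥤ Ab` is additive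
(it is right adjoint to the constant diagram functor). -/
instance limAbAdditive :
    (lim : (Cᵒᵖ ⥤ AddCommGrpCat.{u}) ⥤ AddCommGrpCat.{u}).Additive :=
  Functor.additive_of_preserves_binary_products _

variable {C}

/-- `higherLim i F` is the `i`-th higher inverse limit of a contravariant functor `F` from
the small category `C` to abelian groups: the value at `F` of the `i`-th right derived functor
of the inverse limit functor. -/
noncomputable def higherLim (i : ℕ) (F : Cᵒᵖ ⥤ AddCommGrpCat.{u}) : AddCommGrpCat.{u} :=
  ((lim : (Cᵒᵖ ⥤ AddCommGrpCat.{u}) ⥤ AddCommGrpCat.{u}).rightDerived i).obj F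

end HigherLimits

/-! ### Orbit categories -/

/-- The orbit category `𝒪_S(G)`: its objects are the subgroups of `G` contained in `S`. -/
@[ext]
structure OrbitCat {G : Type u} [Group G] (S : Subgroup G) : Type u where
  /-- The underlying subgroup of `G`. -/
  grp : Subgroup G
  le : grp ≤ S

namespace OrbitCat

variable {G : Type u} [Group G] {S : Subgroup G}

/-- Morphisms `P ⟶ Q` are the `G`-equivariant maps `G ⧸ P → G ⧸ Q`. -/
instance : SmallCategory (OrbitCat S) where
  Hom P Q := (G ⧸ P.grp) →[G] (G ⧸ Q.grp)
  id P := MulActionHom.id G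
  comp f g := MulActionHom.comp g f

/-- The equivariant map of cosets underlying a morphism of the orbit category. -/
def toMap {P Q : OrbitCat S} (φ : P ⟶ Q) : (G ⧸ P.grp) →[G] (G ⧸ Q.grp) := φ

/-- A chosen `a : G` with `φ (gP) = gaQ` for all `g`. -/
noncomputable def rep {P Q : OrbitCat S} (φ : P ⟶ Q) : G :=
  (toMap φ ((1 : G) : G ⧸ P.grp)).out

lemma toMap_mk {P Q : OrbitCat S} (φ : P ⟶ Q) (g : G) :
    toMap φ (g : G ⧸ P.grp) = ((g * rep φ : G) : G ⧸ Q.grp) := by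
  have h : (g : G ⧸ P.grp) = g • ((1 : G) : G ⧸ P.grp) := by
    simp
  have h2 : ((rep φ : G) : G ⧸ Q.grp) = toMap φ ((1 : G) : G ⧸ P.grp) :=
    QuotientGroup.out_eq' _
  rw [h, map_smul, ← h2]
  simp

/-- When `Q` is trivial, the element `a` is determined by `φ`. -/
lemma rep_eq {P Q : OrbitCat S} (φ : P ⟶ Q) (hQ : Q.grp = ⊥) (a : G)
    (h : toMap φ ((1 : G) : G ⧸ P.grp) = (a : G ⧸ Q.grp)) : rep φ = a := by
  have h2 := toMap_mk φ 1
  rw [h, one_mul, QuotientGroup.eq, hQ, Subgroup.mem_bot, inv_mul_eq_one] at h2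
  exact h2.symm

/-- A morphism to the trivial subgroup only exists from the trivial subgroup. -/
lemma eq_bot {P Q : OrbitCat S} (φ : P ⟶ Q) (hQ : Q.grp = ⊥) : P.grp = ⊥ := by
  rw [Subgroup.eq_bot_iff_forall]
  intro x hx
  have h1 : (x : G ⧸ P.grp) = ((1 : G) : G ⧸ P.grp) := by
    rw [QuotientGroup.eq]; simpa using hx
  have h2 := congrArg (toMap φ) h1
  rw [toMap_mk, toMap_mk, QuotientGroup.eq, hQ, Subgroup.mem_bot, inv_mul_eq_one] at h2
  simpa using h2

lemma rep_id (P : OrbitCat S) (hP : P.grp = ⊥) : rep (𝟙 P) = 1 :=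
  rep_eq _ hP _ rfl

lemma rep_comp {P Q R : OrbitCat S} (φ : P ⟶ Q) (ψ : Q ⟶ R) (hR : R.grp = ⊥) :
    rep (φ ≫ ψ) = rep φ * rep ψ := by
  apply rep_eq _ hR
  change toMap ψ (toMap φ _) = _
  rw [toMap_mk, toMap_mk, one_mul]

end OrbitCat

/-! ### The functors `F_M` and the groups `Λ^i(Γ; M)` -/

section LambdaFunctors

variable {k : Type*} [Semiring k] {G : Type u} [Group G] {M : Type u} [AddCommGroup M]
  [Module k M] (ρ : Representation k G M)

open Classical in
/-- The value of `F_M` at a subgroup: it is `M` on the trivial subgroup, `0` on all others. -/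
noncomputable def atomicObj (M : Type u) [AddCommGroup M] (P : Subgroup G) : AddSubgroup M :=
  if P = ⊥ then ⊤ else ⊥

lemma mem_atomicObj {P : Subgroup G} {m : M} : m ∈ atomicObj M P ↔ (P ≠ ⊥ → m = 0) := by
  unfold atomicObj
  split_ifs with h <;> simp [h]

/-- The map `F_M(Q) → F_M(P)` induced by `φ : G/P → G/Q`, `φ(gP) = gaQ`, is `m ↦ a m`
(if `Q ≠ 1` then its source is zero). -/
noncomputable def atomicMap {S : Subgroup G} {P Q : OrbitCat S} (φ : P ⟶ Q) :
    atomicObj M Q.grp →+ atomicObj M P.grp where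
  toFun m := ⟨ρ (OrbitCat.rep φ) m.1, mem_atomicObj.2 fun hP => by
    rw [mem_atomicObj.1 m.2 fun hQ => hP (OrbitCat.eq_bot φ hQ), map_zero]⟩
  map_zero' := by ext; simp
  map_add' x y := by ext; simp

/-- The functor `F_M : 𝒪_S(G)ᵒᵖ ⥤ Ab`, equal to `M` on the trivial subgroup and to `0` on all
other subgroups, where `Aut(1) ≅ G` acts on `F_M(1) = M` through `ρ`. -/
noncomputable def atomicFunctor (S : Subgroup G) : (OrbitCat S)ᵒᵖ ⥤ AddCommGrpCat.{u} where
  obj P := AddCommGrpCat.of (atomicObj M P.unop.grp)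
  map φ := AddCommGrpCat.ofHom (atomicMap ρ φ.unop)
  map_id P := by
    ext m
    by_cases h : P.unop.grp = ⊥
    · change ρ (OrbitCat.rep (𝟙 P.unop)) m.1 = m.1
      rw [OrbitCat.rep_id _ h]; simp
    · change ρ (OrbitCat.rep (𝟙 P.unop)) m.1 = m.1
      rw [mem_atomicObj.1 m.2 h, map_zero]
  map_comp {P Q R} φ ψ := by
    ext m
    change ρ (OrbitCat.rep (ψ.unop ≫ φ.unop)) m.1
      = ρ (OrbitCat.rep ψ.unop) (ρ (OrbitCat.rep φ.unop) m.1)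
    by_cases h : P.unop.grp = ⊥
    · rw [OrbitCat.rep_comp _ _ h, map_mul]; rfl
    · rw [mem_atomicObj.1 m.2 h]; simp

/-- `Λ^i(G; M)`, computed over the orbit category of the Sylow `p`-subgroup `T` of `G`. -/
noncomputable def Lambda {p : ℕ} (T : Sylow p G) (i : ℕ) : AddCommGrpCat.{u} :=
  higherLim i (atomicFunctor ρ (T : Subgroup G))

end LambdaFunctors

/-! ### Wreath products and the natural module -/

section Modules

variable {k G Q M : Type*} [Semiring k] [Group G] [Group Q] [AddCommGroup M] [Module k M]

/-- For a `G`-module `M`, the module `M^Q` for the regular wreath product `G ≀ Q = G^Q ⋊ Q`: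
`G^Q` acts coordinatewise, and `Q` permutes the coordinates by translation. -/
def wreathRep (Q : Type*) [Group Q] (ρ : Representation k G M) :
    Representation k (G ≀ᵣ Q) (Q → M) where
  toFun w :=
    { toFun := fun ξ x => ρ (w.left x) (ξ (w.right⁻¹ * x))
      map_add' := fun ξ η => by ext x; simp
      map_smul' := fun c ξ => by ext x; simp }
  map_one' := by ext; simp
  map_mul' v w := by ext; simp [mul_assoc]

/-- The permutation module `k^X` of the symmetric group of `X`: `(σ f)(x) = f (σ⁻¹ x)`. -/
def permRep (k X : Type*) [Semiring k] : Representation k (Equiv.Perm X) (X → k) where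
  toFun σ := LinearMap.funLeft k k (σ⁻¹ : Equiv.Perm X)
  map_one' := by ext; simp [LinearMap.funLeft_apply]
  map_mul' σ τ := by ext; simp [LinearMap.funLeft_apply]

/-- The diagonal (constant vectors) in `(𝔽_p)^(p+1)`. -/
abbrev diagonalSubmodule (p : ℕ) : Submodule (ZMod p) (Fin (p + 1) → ZMod p) :=
  Submodule.span (ZMod p) {fun _ => 1}

/-- The natural module `V` of the symmetric group on `p + 1` letters: the `(p+1)`-dimensional
permutation module over `𝔽_p` modulo the diagonal. -/
abbrev NaturalModule (p : ℕ) : Type :=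
  (Fin (p + 1) → ZMod p) ⧸ diagonalSubmodule p

/-- The action of the symmetric group on the natural module. -/
def naturalRep (p : ℕ) :
    Representation (ZMod p) (Equiv.Perm (Fin (p + 1))) (NaturalModule p) :=
  (permRep (ZMod p) (Fin (p + 1))).quotient (diagonalSubmodule p) fun σ => by
    rw [Submodule.span_le, Set.singleton_subset_iff]
    exact Submodule.subset_span rfl

/-- The cyclic group of order `p`, written multiplicatively. -/
abbrev Cyc (p : ℕ) : Type := Multiplicative (ZMod p)

end Modules

/-! The proof shifts dimension: passing from `G` to `G ≀ Q` with `|Q| = p` raises the degree of `Λ`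
by one, so `Λ^3` of the twofold wreath product is `Λ^1` of the symmetric group with coefficients in
`V`, which is computed by hand.

The shift embeds the atomic functor `F_M` in a larger presheaf `E_K` (`FixedFamily.fixedOff`), for
`K` a normal subgroup: `E_K(P)` is `M^P` when `P ∩ K = 1` and `0` otherwise. If all higher limits of
`E_K` vanish, then `Λ^{n+1}` is `lim^n` of `E_K / F_M`, which lives on nontrivial subgroups only. To
recognise such presheaves, a span of groups `G ← H → L` (injective to the left, surjective to the
right, with `P ↦ ι(q⁻¹ P)` respecting the chosen `p`-subgroups) induces a functor of orbit
categories. Coinduction along it is exact, because fixed points of `G`-sets under `ker q` split into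
`L`-orbits, and so it preserves higher limits (`nonempty_higherLim_coind_iso`,
`OrbitSpan.homsAreCoproducts`). A presheaf concentrated on the class of one subgroup `C` is
coinduced from an atomic functor for `N(C)/C` (`OrbitSpan.isIso_unit`).

Vanishing (`atomicVanishing`): if an element of order `p` acts trivially on `M`, all `Λ^i` are zero.
With `K` the kernel of the action, transfer to a Sylow subgroup makes `E_K` acyclic; the quotient
`E_K / F_M` is filtered by conjugacy classes, and each layer is an atomic functor for a smaller
group `N(P)/P` to which induction applies.

Wreath step (`nonempty_Lambda_wreath`): for `K = G^Q` the presheaf `E_K` is coinduced from the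
atomic functor of `G^Q` acting on `M` through one coordinate, so it vanishes by the previous point.
The quotient is concentrated on the complements of `G^Q`. These are all conjugate to `Q`, whose
normalizer is `G × Q`, and `(M^Q)^Q = M`; hence `lim^n` of the quotient is `Λ^n(G; M)`.

Base case (`nonempty_Lambda_one_naturalRep`): the full fixed-point functor of `V` has no higher
limits and no invariants, so `Λ^1` is the limit of fixed points over nontrivial `p`-subgroups. That
limit is `V^T`, a line. -/

/-! ### Right derived functors: comparison with Ext and transport along exact functors -/

section RightDerived

open Abelian

universe v' u' w' v'' u''

variable {A : Type u'} [Category.{v'} A] [Abelian A] [EnoughInjectives A]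

section ExtComparison

variable [HasExt.{w'} A] (G : A ⥤ AddCommGrpCat.{v''}) [G.Additive] (Z : A)

/-- If the additive functor `G` is corepresented by `Z`, then its right derived functors are the
groups `Ext Z -`. -/
theorem nonempty_rightDerived_addEquiv_ext [PreservesFiniteLimits G]
    (e : ∀ F : A, G.obj F ≃+ (Z ⟶ F))
    (he : ∀ {F F' : A} (f : F ⟶ F') (x : G.obj F), e F' (G.map f x) = e F x ≫ f)
    (n : ℕ) (F : A) : Nonempty ((G.rightDerived n).obj F ≃+ Ext.{w'} Z F n) := by
  cases n with
  | zero =>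
    exact ⟨((G.rightDerivedZeroIsoSelf.app F).addCommGroupIsoToAddEquiv.trans (e F)).trans
      Ext.addEquiv₀.symm⟩
  | succ n =>
    let I : InjectiveResolution F := injectiveResolution F
    let K := (G.mapHomologicalComplex (ComplexShape.up ℕ)).obj I.cocomplex
    let S := K.sc' n (n + 1) (n + 2)
    have hcyc : ∀ x : AddMonoidHom.ker S.g.hom,
        e (I.cocomplex.X (n + 1)) x.1 ≫ I.cocomplex.d (n + 1) (n + 2) = 0 := by
      rintro ⟨x, hx⟩
      change G.map (I.cocomplex.d (n + 1) (n + 2)) x = 0 at hx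
      exact (he _ _).symm.trans (by rw [hx, map_zero])
    let φ : AddMonoidHom.ker S.g.hom →+ Ext.{w'} Z F (n + 1) :=
      AddMonoidHom.mk' (fun x => I.extMk (e (I.cocomplex.X (n + 1)) x.1) (n + 2) rfl (hcyc x))
        (fun x y => by
          rw [I.add_extMk]
          congr 1
          exact map_add (e _) x.1 y.1)
    have hφ : Function.Surjective φ := by
      intro α
      obtain ⟨f, hf, rfl⟩ := I.extMk_surjective α (n + 2) rfl
      refine ⟨⟨(e _).symm f, ?_⟩, ?_⟩
      · change G.map (I.cocomplex.d (n + 1) (n + 2)) _ = 0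
        apply (e _).injective
        rw [he, AddEquiv.apply_symm_apply, hf, map_zero]
      · change I.extMk (e _ ((e _).symm f)) (n + 2) rfl (by rw [AddEquiv.apply_symm_apply, hf]) = _
        congr 1
        exact (e _).apply_symm_apply f
    have hker : AddMonoidHom.range S.abToCycles = AddMonoidHom.ker φ := by
      ext x
      rw [AddMonoidHom.mem_ker]
      change _ ↔ I.extMk _ (n + 2) rfl (hcyc x) = 0
      rw [I.extMk_eq_zero_iff _ _ _ _ n rfl]
      constructor
      · rintro ⟨y, rfl⟩
        exact ⟨e _ y, (he _ _).symm⟩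
      · rintro ⟨g, hg⟩
        refine ⟨(e _).symm g, Subtype.ext ((e (I.cocomplex.X (n + 1))).injective ?_)⟩
        change e _ (G.map (I.cocomplex.d n (n + 1)) ((e _).symm g)) = _
        rw [he, AddEquiv.apply_symm_apply, hg]
    have i1 : (G.rightDerived (n + 1)).obj F ≅ S.homology :=
      I.isoRightDerivedObj G (n + 1) ≪≫
        ShortComplex.homologyMapIso (K.isoSc' n (n + 1) (n + 2) (by simp) (by simp))
    exact ⟨((i1 ≪≫ S.abHomologyIso).addCommGroupIsoToAddEquiv.trans
      (QuotientAddGroup.quotientAddEquivOfEq hker)).trans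
      (QuotientAddGroup.quotientKerEquivOfSurjective φ hφ)⟩

end ExtComparison

section Transport

variable {B : Type u''} [Category.{v''} B] [Abelian B] [EnoughInjectives B]
  {D : Type*} [Category* D] [Abelian D]

/-- An exact functor preserving injective objects maps injective resolutions to injective
resolutions. -/
noncomputable def mapInjectiveResolution (R : A ⥤ B) [R.Additive] [PreservesFiniteLimits R]
    [PreservesFiniteColimits R] (hR : ∀ I : A, Injective I → Injective (R.obj I)) {F : A}
    (I : InjectiveResolution F) : InjectiveResolution (R.obj F) where
  cocomplex := (R.mapHomologicalComplex _).obj I.cocomplex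
  injective n := hR _ (I.injective n)
  ι := ((HomologicalComplex.singleMapHomologicalComplex R (ComplexShape.up ℕ) 0).inv.app F) ≫
    (R.mapHomologicalComplex _).map I.ι
  quasiIso := inferInstance

/-- One injective resolution of `F` computes both sides, since its image under `R` is an injective
resolution of `R.obj F`. -/
theorem nonempty_rightDerived_iso_of_exact (R : A ⥤ B) [R.Additive] [PreservesFiniteLimits R]
    [PreservesFiniteColimits R] (hR : ∀ I : A, Injective I → Injective (R.obj I))
    (G : A ⥤ D) [G.Additive] (H : B ⥤ D) [H.Additive] (e : R ⋙ H ≅ G) (n : ℕ) (F : A) :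
    Nonempty ((H.rightDerived n).obj (R.obj F) ≅ (G.rightDerived n).obj F) := by
  let I : InjectiveResolution F := injectiveResolution F
  exact ⟨(mapInjectiveResolution R hR I).isoRightDerivedObj H n ≪≫
    (HomologicalComplex.homologyFunctor D _ n).mapIso
      ((NatIso.mapHomologicalComplex e (ComplexShape.up ℕ)).app I.cocomplex) ≪≫
    (I.isoRightDerivedObj G n).symm⟩

end Transport

end RightDerived

/-! ### Higher limits as Ext out of the constant presheaf, and dimension shifting -/

section HigherLimits

open Abelian Opposite

variable {C : Type u} [SmallCategory C]

/-- The constant presheaf with value the integers, which corepresents the limit functor. -/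
noncomputable abbrev constInt (C : Type u) [SmallCategory C] : Cᵒᵖ ⥤ AddCommGrpCat.{u} :=
  (Functor.const Cᵒᵖ).obj (AddCommGrpCat.of (ULift.{u} ℤ))

theorem uliftInt_hom_apply {X : AddCommGrpCat.{u}} (f : AddCommGrpCat.of (ULift.{u} ℤ) ⟶ X)
    (m : ℤ) : f ⟨m⟩ = m • f ⟨1⟩ := by
  rw [← map_zsmul]
  congr 1
  exact ULift.ext _ _ (mul_one m).symm

def uliftIntHomEquiv (X : AddCommGrpCat.{u}) :
    (AddCommGrpCat.of (ULift.{u} ℤ) ⟶ X) ≃+ X where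
  toFun f := f ⟨1⟩
  invFun x := AddCommGrpCat.ofHom ((zmultiplesHom _ x).comp AddEquiv.ulift.toAddMonoidHom)
  left_inv f := by
    ext ⟨m⟩
    exact (uliftInt_hom_apply f m).symm
  right_inv x := by
    change (1 : ℤ) • x = x
    rw [one_zsmul]
  map_add' _ _ := rfl

noncomputable def limEquivHom (F : Cᵒᵖ ⥤ AddCommGrpCat.{u}) :
    (lim : (Cᵒᵖ ⥤ AddCommGrpCat.{u}) ⥤ AddCommGrpCat.{u}).obj F ≃+ (constInt C ⟶ F) :=
  ((constLimAdj.homAddEquiv (AddCommGrpCat.of (ULift.{u} ℤ)) F).trans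
    (uliftIntHomEquiv _)).symm

theorem limEquivHom_naturality {F F' : Cᵒᵖ ⥤ AddCommGrpCat.{u}} (f : F ⟶ F') 
    (x : (lim : (Cᵒᵖ ⥤ AddCommGrpCat.{u}) ⥤ AddCommGrpCat.{u}).obj F) :
    limEquivHom F' (lim.map f x) = limEquivHom F x ≫ f := by
  obtain ⟨g, rfl⟩ := (limEquivHom F).symm.surjective x
  rw [AddEquiv.apply_symm_apply, ← AddEquiv.eq_symm_apply]
  change _ = constLimAdj.homEquiv _ _ (g ≫ f) _
  rw [Adjunction.homEquiv_naturality_right]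
  rfl

instance abPresheafHasExt : HasExt.{u} (Cᵒᵖ ⥤ AddCommGrpCat.{u}) := 
  hasExt_of_enoughInjectives _

theorem nonempty_higherLim_addEquiv_ext (n : ℕ) (F : Cᵒᵖ ⥤ AddCommGrpCat.{u}) :
    Nonempty (higherLim n F ≃+ Ext.{u} (constInt C) F n) :=
  nonempty_rightDerived_addEquiv_ext _ _ limEquivHom limEquivHom_naturality n F

noncomputable def higherLimIso (n : ℕ) {F F' : Cᵒᵖ ⥤ AddCommGrpCat.{u}} (e : F ≅ F') :
    higherLim n F ≅ higherLim n F' :=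
  ((lim : (Cᵒᵖ ⥤ AddCommGrpCat.{u}) ⥤ AddCommGrpCat.{u}).rightDerived n).mapIso e

theorem isZero_higherLim_iff (n : ℕ) (F : Cᵒᵖ ⥤ AddCommGrpCat.{u}) :
    IsZero (higherLim n F) ↔ Subsingleton (Ext.{u} (constInt C) F n) := by
  obtain ⟨e⟩ := nonempty_higherLim_addEquiv_ext n F
  rw [AddCommGrpCat.isZero_iff_subsingleton]
  exact e.toEquiv.subsingleton_congr

/-- A retract up to isomorphism of a presheaf with vanishing `n`-th higher limit also has
vanishing `n`-th higher limit. -/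
theorem isZero_higherLim_of_retract {n : ℕ} {F E : Cᵒᵖ ⥤ AddCommGrpCat.{u}} (i : F ⟶ E)
    (r : E ⟶ F) [IsIso (i ≫ r)] (h : IsZero (higherLim n E)) : IsZero (higherLim n F) := by
  let L := (lim : (Cᵒᵖ ⥤ AddCommGrpCat.{u}) ⥤ AddCommGrpCat.{u}).rightDerived n
  change IsZero (L.obj F)
  have h0 : L.map (i ≫ r) = 0 := by
    rw [L.map_comp]
    exact (congrArg _ (h.eq_of_src (L.map r) 0)).trans comp_zero
  rw [IsZero.iff_id_eq_zero, ← cancel_mono (L.map (i ≫ r)), h0, comp_zero, comp_zero]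

/-- All higher limits of the presheaf, including the limit itself, vanish. -/
def HigherLimsVanish (F : Cᵒᵖ ⥤ AddCommGrpCat.{u}) : Prop :=
  ∀ n, IsZero (higherLim n F)

theorem HigherLimsVanish.of_iso {F F' : Cᵒᵖ ⥤ AddCommGrpCat.{u}} (h : HigherLimsVanish F)
    (e : F ≅ F') : HigherLimsVanish F' :=
  fun n => (h n).of_iso (higherLimIso n e.symm)

section ShortExact

variable {S : ShortComplex (Cᵒᵖ ⥤ AddCommGrpCat.{u})} (hS : S.ShortExact)

include hS

theorem HigherLimsVanish.middle (h₁ : HigherLimsVanish S.X₁) (h₃ : HigherLimsVanish S.X₃) :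
    HigherLimsVanish S.X₂ := by
  intro n
  rw [isZero_higherLim_iff]
  have := (isZero_higherLim_iff _ _).1 (h₁ n)
  have := (isZero_higherLim_iff _ _).1 (h₃ n)
  refine subsingleton_of_forall_eq 0 fun x => ?_
  obtain ⟨y, rfl⟩ := Ext.covariant_sequence_exact₂ _ hS x (Subsingleton.elim _ _)
  rw [Subsingleton.elim y 0, Ext.zero_comp]

/-- Dimension shifting: the connecting map of the long exact Ext sequence is an isomorphism because
its neighbours, the terms of the middle presheaf, vanish. -/
theorem nonempty_higherLim_succ_addEquiv (h₂ : HigherLimsVanish S.X₂) (n : ℕ) :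
    Nonempty (higherLim (n + 1) S.X₁ ≃+ higherLim n S.X₃) := by
  obtain ⟨e₁⟩ := nonempty_higherLim_addEquiv_ext (n + 1) S.X₁
  obtain ⟨e₃⟩ := nonempty_higherLim_addEquiv_ext n S.X₃
  have := (isZero_higherLim_iff _ _).1 (h₂ n)
  have := (isZero_higherLim_iff _ _).1 (h₂ (n + 1))
  have hb : Function.Bijective (hS.extClass.postcomp (constInt C) (rfl : n + 1 = n + 1)) := by
    constructor
    · rw [injective_iff_map_eq_zero]
      intro x hx
      obtain ⟨y, rfl⟩ := Ext.covariant_sequence_exact₃ _ hS x rfl hx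
      rw [Subsingleton.elim y 0, Ext.zero_comp]
    · intro x
      exact Ext.covariant_sequence_exact₁ _ hS x (Subsingleton.elim _ _) rfl
  exact ⟨e₁.trans ((AddEquiv.ofBijective _ hb).symm.trans e₃.symm)⟩

theorem HigherLimsVanish.left (h₂ : HigherLimsVanish S.X₂) (h₃ : HigherLimsVanish S.X₃) :
    HigherLimsVanish S.X₁ := by
  intro n
  rw [isZero_higherLim_iff]
  have := (isZero_higherLim_iff _ _).1 (h₂ n)
  refine subsingleton_of_forall_eq 0 fun x => ?_
  cases n with
  | zero =>
    have := hS.mono_f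
    exact Ext.postcomp_mk₀_injective_of_mono _ S.f (Subsingleton.elim _ _)
  | succ n =>
    have := (isZero_higherLim_iff _ _).1 (h₃ n)
    obtain ⟨y, rfl⟩ := Ext.covariant_sequence_exact₁ _ hS x (Subsingleton.elim _ _) rfl
    rw [Subsingleton.elim y 0, Ext.zero_comp]

end ShortExact

section WeaklyTerminal

variable {t : C} (ht : ∀ c : C, Nonempty (c ⟶ t))

/-- The morphism out of the constant presheaf determined by an element of the value at a weakly
terminal object. -/
noncomputable def constIntDesc (F : Cᵒᵖ ⥤ AddCommGrpCat.{u}) (x : F.obj (op t))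
    (hx : ∀ (c : C) (φ ψ : c ⟶ t), F.map φ.op x = F.map ψ.op x) : constInt C ⟶ F where
  app c := AddCommGrpCat.ofHom
    ((zmultiplesHom _ (F.map (ht c.unop).some.op x)).comp AddEquiv.ulift.toAddMonoidHom)
  naturality c d f := by
    ext ⟨n⟩
    change n • F.map (ht d.unop).some.op x = F.map f (n • F.map (ht c.unop).some.op x)
    rw [map_zsmul, hx _ _ (f.unop ≫ (ht c.unop).some), op_comp, F.map_comp]
    rfl

theorem constIntDesc_app (F : Cᵒᵖ ⥤ AddCommGrpCat.{u}) (x : F.obj (op t))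
    (hx : ∀ (c : C) (φ ψ : c ⟶ t), F.map φ.op x = F.map ψ.op x) :
    (constIntDesc ht F x hx).app (op t) ⟨1⟩ = x := by
  change (1 : ℤ) • F.map (ht t).some.op x = x
  rw [one_zsmul, hx _ _ (𝟙 t)]
  simp

include ht in
theorem constInt_hom_ext {F : Cᵒᵖ ⥤ AddCommGrpCat.{u}} {f g : constInt C ⟶ F}
    (h : f.app (op t) ⟨1⟩ = g.app (op t) ⟨1⟩) : f = g := by
  ext c ⟨n⟩
  have key : ∀ f : constInt C ⟶ F,
      f.app c ⟨n⟩ = n • F.map (ht c.unop).some.op (f.app (op t) ⟨1⟩) := by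
    intro f
    have h1 := ConcreteCategory.congr_hom (f.naturality (ht c.unop).some.op) ⟨1⟩
    change f.app c ⟨1⟩ = F.map _ (f.app (op t) ⟨1⟩) at h1
    rw [← h1]
    exact uliftInt_hom_apply (f.app c) n
  change f.app c ⟨n⟩ = g.app c ⟨n⟩
  rw [key, key, h]

-- A compatible family is determined by its component at `t`. Conversely every element of `F(t)`
-- spreads to one, since any choice of morphism `c ⟶ t` gives the same restriction.
include ht in
theorem nonempty_higherLim_zero_addEquiv (F : Cᵒᵖ ⥤ AddCommGrpCat.{u})
    (hF : ∀ (c : C) (φ ψ : c ⟶ t), F.map φ.op = F.map ψ.op) :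
    Nonempty (higherLim 0 F ≃+ F.obj (op t)) := by
  obtain ⟨e⟩ := nonempty_higherLim_addEquiv_ext 0 F
  refine ⟨(e.trans Ext.addEquiv₀).trans (AddEquiv.symm
    { toFun := fun x => constIntDesc ht F x fun c φ ψ => by rw [hF c φ ψ]
      invFun := fun f => f.app (op t) ⟨1⟩
      left_inv := fun x => constIntDesc_app ht F x _
      right_inv := fun f => constInt_hom_ext ht (constIntDesc_app ht F _ _)
      map_add' := fun x y => constInt_hom_ext ht ?_ })⟩
  rw [constIntDesc_app]
  change _ = (constIntDesc ht F x _).app (op t) ⟨1⟩ + (constIntDesc ht F y _).app (op t) ⟨1⟩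
  rw [constIntDesc_app, constIntDesc_app]

end WeaklyTerminal

/-- With a terminal object, the constant presheaf is the free presheaf on a representable one, hence
projective. -/
theorem isZero_higherLim_succ_of_isTerminal {t : C} (ht : IsTerminal t)
    (F : Cᵒᵖ ⥤ AddCommGrpCat.{u}) (n : ℕ) : IsZero (higherLim (n + 1) F) := by
  rw [isZero_higherLim_iff]
  have : Projective (constInt C) := ⟨fun {E X} f e _ => by
    have he : Epi (e.app (op t)) := inferInstance
    obtain ⟨x, hx⟩ := (AddCommGrpCat.epi_iff_surjective _).1 he (f.app (op t) ⟨1⟩)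
    refine ⟨constIntDesc (fun c => ⟨ht.from c⟩) E x fun c φ ψ => by rw [ht.hom_ext φ ψ],
      constInt_hom_ext (fun c => ⟨ht.from c⟩) ?_⟩
    change e.app (op t) ((constIntDesc _ E x _).app (op t) ⟨1⟩) = _
    rw [constIntDesc_app, hx]⟩
  exact Ext.subsingleton_of_projective _ _ _

theorem higherLimsVanish_of_isTerminal {t : C} (ht : IsTerminal t)
    (F : Cᵒᵖ ⥤ AddCommGrpCat.{u}) (hF : IsZero (F.obj (op t))) : HigherLimsVanish F := by
  rintro (_ | n)
  · obtain ⟨e⟩ := nonempty_higherLim_zero_addEquiv (fun c => ⟨ht.from c⟩) F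
      fun c φ ψ => by rw [ht.hom_ext φ ψ]
    rw [AddCommGrpCat.isZero_iff_subsingleton] at hF ⊢
    exact e.toEquiv.subsingleton
  · exact isZero_higherLim_succ_of_isTerminal ht F n

end HigherLimits

/-! ### Coinduction of presheaves and invariance of higher limits -/

section Coinduction

open Opposite

variable {C D : Type u} [SmallCategory C] [SmallCategory D] (Φ : C ⥤ D)

/-- The compatible families of elements of `F c` indexed by the morphisms `Φ c ⟶ x`. -/
def coindObj (F : Cᵒᵖ ⥤ AddCommGrpCat.{u}) (x : D) :
    AddSubgroup (∀ c : C, (Φ.obj c ⟶ x) → F.obj (op c)) where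
  carrier := {s | ∀ ⦃c d : C⦄ (f : c ⟶ d) (v : Φ.obj d ⟶ x),
    F.map f.op (s d v) = s c (Φ.map f ≫ v)}
  zero_mem' c d f v := map_zero _
  add_mem' hs ht c d f v := by
    rw [Pi.add_apply, Pi.add_apply, map_add, hs, ht]; rfl
  neg_mem' hs c d f v := by
    rw [Pi.neg_apply, Pi.neg_apply, map_neg, hs]; rfl

/-- The right Kan extension of presheaves along `Φ`, with an explicit description of its
values. -/
def coind : (Cᵒᵖ ⥤ AddCommGrpCat.{u}) ⥤ (Dᵒᵖ ⥤ AddCommGrpCat.{u}) where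
  obj F :=
    { obj x := AddCommGrpCat.of (coindObj Φ F x.unop)
      map {x y} g := AddCommGrpCat.ofHom
        { toFun s := ⟨fun c v => s.1 c (v ≫ g.unop), fun c d f v =>
            (s.2 f (v ≫ g.unop)).trans (congrArg (s.1 c) (Category.assoc _ _ _).symm)⟩
          map_zero' := rfl
          map_add' _ _ := rfl }
      map_id x := by
        ext s c v
        exact congrArg (s.1 c) (Category.comp_id v)
      map_comp f g := by
        ext s c v
        exact congrArg (s.1 c) (Category.assoc _ _ _).symm }
  map {F F'} α :=
    { app x := AddCommGrpCat.ofHom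
        { toFun s := ⟨fun c v => α.app (op c) (s.1 c v), fun c d f v =>
            (ConcreteCategory.congr_hom (α.naturality f.op) (s.1 d v)).symm.trans
              (congrArg (α.app (op c)) (s.2 f v))⟩
          map_zero' := Subtype.ext (funext fun c => funext fun v => map_zero _)
          map_add' _ _ := Subtype.ext (funext fun c => funext fun v => map_add _ _ _) }
      naturality _ _ _ := rfl }
  map_id _ := rfl
  map_comp _ _ := rfl

instance : (coind Φ).Additive where
  map_add := rfl

/-- Restriction of presheaves along `Φ`. -/
abbrev presheafRes : (Dᵒᵖ ⥤ AddCommGrpCat.{u}) ⥤ (Cᵒᵖ ⥤ AddCommGrpCat.{u}) :=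
  (Functor.whiskeringLeft _ _ _).obj Φ.op

/-- The morphism to the coinduced presheaf which corresponds to a morphism from the restricted
presheaf. -/
def coindLift {G : Dᵒᵖ ⥤ AddCommGrpCat.{u}} {F : Cᵒᵖ ⥤ AddCommGrpCat.{u}}
    (α : (presheafRes Φ).obj G ⟶ F) : G ⟶ (coind Φ).obj F where
  app x := AddCommGrpCat.ofHom
    { toFun g := ⟨fun c v => α.app (op c) (G.map v.op g), fun c d f v => by
        refine (ConcreteCategory.congr_hom (α.naturality f.op) (G.map v.op g)).symm.trans ?_
        exact congrArg (α.app (op c))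
          (ConcreteCategory.congr_hom (G.map_comp v.op (Φ.map f).op) g).symm⟩
      map_zero' := Subtype.ext (funext fun c => funext fun v =>
        (congrArg _ (map_zero (G.map v.op).hom)).trans (map_zero (α.app (op c)).hom))
      map_add' a b := Subtype.ext (funext fun c => funext fun v =>
        (congrArg _ (map_add (G.map v.op).hom a b)).trans (map_add (α.app (op c)).hom _ _)) }
  naturality x y g := by
    ext a
    refine Subtype.ext (funext fun c => funext fun v => ?_)
    change α.app (op c) (G.map v.op (G.map g a)) = α.app (op c) (G.map (v ≫ g.unop).op a)
    rw [op_comp, G.map_comp]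
    rfl

def coindAdj : presheafRes Φ ⊣ coind Φ :=
  Adjunction.mkOfHomEquiv
    { homEquiv G F :=
        { toFun α := coindLift Φ α
          invFun β :=
            { app c := AddCommGrpCat.ofHom
                { toFun g := (β.app (op (Φ.obj c.unop)) g).1 c.unop (𝟙 _)
                  map_zero' := by rw [map_zero]; rfl
                  map_add' a b := by rw [map_add]; rfl }
              naturality c d f := by
                ext g
                change (β.app _ (G.map (Φ.map f.unop).op g)).1 d.unop (𝟙 _) =
                  F.map f ((β.app _ g).1 c.unop (𝟙 _))
                have h1 := ConcreteCategory.congr_hom (β.naturality (Φ.map f.unop).op) g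
                have h2 := (β.app (op (Φ.obj c.unop)) g).2 f.unop (𝟙 _)
                refine Eq.trans ?_ h2.symm
                refine (congrFun (congrFun (congrArg Subtype.val h1) d.unop) (𝟙 _)).trans ?_
                change (β.app _ g).1 d.unop _ = _
                simp }
          left_inv α := by
            ext c g
            change α.app c (G.map (𝟙 _) g) = α.app c g
            rw [G.map_id]
            rfl
          right_inv β := by
            ext x g
            refine Subtype.ext (funext fun c => funext fun v => ?_)
            change (β.app _ (G.map v.op g)).1 c (𝟙 _) = (β.app x g).1 c v
            have h1 := ConcreteCategory.congr_hom (β.naturality v.op) g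
            refine (congrFun (congrFun (congrArg Subtype.val h1) c) (𝟙 _)).trans ?_
            change (β.app x g).1 c (𝟙 _ ≫ v) = _
            rw [Category.id_comp] }
      homEquiv_naturality_left_symm _ _ := rfl
      homEquiv_naturality_right _ _ := rfl }

/-- The components of an element of a coinduced presheaf. -/
def coindVal (F : Cᵒᵖ ⥤ AddCommGrpCat.{u}) {x : D} (c : C) (v : Φ.obj c ⟶ x) :
    ((coind Φ).obj F).obj (op x) →+ F.obj (op c) where
  toFun s := s.1 c v
  map_zero' := rfl
  map_add' _ _ := rfl

section coindVal

variable {Φ} {F : Cᵒᵖ ⥤ AddCommGrpCat.{u}}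

theorem coind_ext {x : D} {s t : ((coind Φ).obj F).obj (op x)}
    (h : ∀ c v, coindVal Φ F c v s = coindVal Φ F c v t) : s = t :=
  Subtype.ext (funext fun c => funext fun v => h c v)

theorem coindVal_map {x y : D} (g : y ⟶ x) (s : ((coind Φ).obj F).obj (op x)) (c : C)
    (v : Φ.obj c ⟶ y) :
    coindVal Φ F c v (((coind Φ).obj F).map g.op s) = coindVal Φ F c (v ≫ g) s := rfl

theorem map_coindVal {x : D} {c d : C} (f : c ⟶ d) (v : Φ.obj d ⟶ x)
    (s : ((coind Φ).obj F).obj (op x)) :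
    F.map f.op (coindVal Φ F d v s) = coindVal Φ F c (Φ.map f ≫ v) s := s.2 f v

theorem coindVal_lift {G : Dᵒᵖ ⥤ AddCommGrpCat.{u}} (α : (presheafRes Φ).obj G ⟶ F) {x : D}
    (g : G.obj (op x)) (c : C) (v : Φ.obj c ⟶ x) :
    coindVal Φ F c v ((coindLift Φ α).app (op x) g) = α.app (op c) (G.map v.op g) := rfl

end coindVal

/-- Every presheaf `c ↦ (Φ c ⟶ x)` is a coproduct of representable presheaves. -/
def HomsAreCoproducts : Prop :=
  ∀ x : D, ∃ (I : Type u) (c : I → C) (w : ∀ i, Φ.obj (c i) ⟶ x),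
    ∀ (d : C) (v : Φ.obj d ⟶ x), ∃! f : Σ i, d ⟶ c i, Φ.map f.2 ≫ w f.1 = v

variable {Φ}

/-- Under the hypothesis a compatible family over `x` is an arbitrary choice of elements at the
generators `(c i, w i)`, so the coinduced presheaf is pointwise a product of values of `F`, and
lifting can be done generator by generator. -/
theorem coind_preservesEpimorphisms (hΦ : HomsAreCoproducts Φ) :
    (coind Φ).PreservesEpimorphisms where
  preserves {F F'} α hα := by
    have hα' : ∀ c, Function.Surjective (α.app c) := fun c =>
      (AddCommGrpCat.epi_iff_surjective _).1 inferInstance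
    rw [NatTrans.epi_iff_epi_app]
    intro x
    rw [AddCommGrpCat.epi_iff_surjective]
    intro s
    obtain ⟨I, c, w, hI⟩ := hΦ x.unop
    choose t ht using fun i => hα' (op (c i)) (s.1 (c i) (w i))
    choose f hf huniq using hI
    refine ⟨⟨fun d v => F.map (f d v).2.op (t (f d v).1), fun d e g v => ?_⟩, ?_⟩
    · have : f d (Φ.map g ≫ v) = ⟨(f e v).1, g ≫ (f e v).2⟩ := by
        refine (huniq _ _ _ ?_).symm
        simp [hf]
      change F.map g.op (F.map (f e v).2.op (t (f e v).1)) = F.map (f d (Φ.map g ≫ v)).2.op (t _)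
      rw [this, op_comp, F.map_comp]
      rfl
    · refine Subtype.ext (funext fun d => funext fun v => ?_)
      change α.app (op d) (F.map (f d v).2.op (t (f d v).1)) = s.1 d v
      refine (ConcreteCategory.congr_hom (α.naturality (f d v).2.op) _).trans ?_
      change F'.map _ (α.app _ (t _)) = _
      rw [ht, s.2, hf]

/-- Coinduction along `Φ` preserves higher limits. -/
theorem nonempty_higherLim_coind_iso (hΦ : HomsAreCoproducts Φ) (n : ℕ)
    (F : Cᵒᵖ ⥤ AddCommGrpCat.{u}) :
    Nonempty (higherLim n ((coind Φ).obj F) ≅ higherLim n F) := by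
  have := coind_preservesEpimorphisms hΦ
  have : PreservesLimitsOfSize.{0, 0} (coind Φ) := (coindAdj Φ).rightAdjoint_preservesLimits
  have := Functor.preservesHomology_of_preservesEpis_and_kernels (coind Φ)
  have := (coind Φ).preservesFiniteColimits_of_preservesHomology
  -- Both functors are right adjoint to the constant presheaf functor, since restricting a constant
  -- presheaf along `Φ` gives a constant presheaf.
  have e : coind Φ ⋙ lim ≅ (lim : (Cᵒᵖ ⥤ AddCommGrpCat.{u}) ⥤ AddCommGrpCat.{u}) :=
    Adjunction.rightAdjointUniq (constLimAdj.comp (coindAdj Φ))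
      (constLimAdj.ofNatIsoLeft (Iso.refl _))
  exact nonempty_rightDerived_iso_of_exact (coind Φ)
    (fun I hI => (coindAdj Φ).map_injective I hI) _ _ e n F

theorem HigherLimsVanish.coind {F : Cᵒᵖ ⥤ AddCommGrpCat.{u}} (hF : HigherLimsVanish F)
    (hΦ : HomsAreCoproducts Φ) : HigherLimsVanish ((coind Φ).obj F) := fun n => by
  obtain ⟨e⟩ := nonempty_higherLim_coind_iso hΦ n F
  exact (hF n).of_iso e

end Coinduction

/-! ### Morphisms of orbit categories in terms of group elements -/

namespace OrbitCat

variable {G : Type u} [Group G] {S : Subgroup G}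

/-- The equivariant map `gP ↦ gaQ`. -/
def homMk {P Q : OrbitCat S} (a : G) (h : ∀ x ∈ P.grp, a⁻¹ * x * a ∈ Q.grp) : P ⟶ Q :=
  show (G ⧸ P.grp) →[G] (G ⧸ Q.grp) from
  { toFun := Quotient.lift (fun g : G => ((g * a : G) : G ⧸ Q.grp)) (by
      intro g g' hg
      rw [QuotientGroup.eq]
      have := h _ (QuotientGroup.leftRel_apply.1 hg)
      convert this using 1
      group)
    map_smul' := by
      rintro g ⟨x⟩
      exact congrArg (QuotientGroup.mk (s := Q.grp)) (mul_assoc g x a) }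

theorem rep_conj_mem {P Q : OrbitCat S} (φ : P ⟶ Q) :
    ∀ x ∈ P.grp, (rep φ)⁻¹ * x * rep φ ∈ Q.grp := by
  intro x hx
  have h1 : (x : G ⧸ P.grp) = ((1 : G) : G ⧸ P.grp) := by
    rw [QuotientGroup.eq]; simpa using hx
  have h2 := congrArg (toMap φ) h1
  rw [toMap_mk, toMap_mk, one_mul, eq_comm, QuotientGroup.eq] at h2
  rwa [mul_assoc]

theorem hom_ext {P Q : OrbitCat S} {φ ψ : P ⟶ Q}
    (h : toMap φ ((1 : G) : G ⧸ P.grp) = toMap ψ ((1 : G) : G ⧸ P.grp)) : φ = ψ := by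
  apply MulActionHom.ext
  rintro ⟨g⟩
  change toMap φ (g : G ⧸ P.grp) = toMap ψ (g : G ⧸ P.grp)
  have hg : (g : G ⧸ P.grp) = g • ((1 : G) : G ⧸ P.grp) := by simp
  rw [hg, map_smul, map_smul, h]

theorem toMap_homMk_one {P Q : OrbitCat S} (a : G) (h : ∀ x ∈ P.grp, a⁻¹ * x * a ∈ Q.grp) :
    toMap (homMk a h) ((1 : G) : G ⧸ P.grp) = (a : G ⧸ Q.grp) :=
  congrArg (QuotientGroup.mk (s := Q.grp)) (one_mul a)

theorem homMk_eq_iff {P Q : OrbitCat S} {a b : G} {ha : ∀ x ∈ P.grp, a⁻¹ * x * a ∈ Q.grp}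
    {hb : ∀ x ∈ P.grp, b⁻¹ * x * b ∈ Q.grp} : homMk a ha = homMk b hb ↔ a⁻¹ * b ∈ Q.grp := by
  rw [← QuotientGroup.eq, ← toMap_homMk_one a ha, ← toMap_homMk_one b hb]
  exact ⟨fun h => by rw [h], hom_ext⟩

theorem homMk_rep {P Q : OrbitCat S} (φ : P ⟶ Q) : homMk (rep φ) (rep_conj_mem φ) = φ := by
  apply hom_ext
  rw [toMap_homMk_one]
  exact QuotientGroup.out_eq' _

theorem exists_eq_homMk {P Q : OrbitCat S} (φ : P ⟶ Q) :
    ∃ (a : G) (h : ∀ x ∈ P.grp, a⁻¹ * x * a ∈ Q.grp), φ = homMk a h :=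
  ⟨rep φ, rep_conj_mem φ, (homMk_rep φ).symm⟩

theorem homMk_comp {P Q R : OrbitCat S} (a b : G) (ha : ∀ x ∈ P.grp, a⁻¹ * x * a ∈ Q.grp)
    (hb : ∀ x ∈ Q.grp, b⁻¹ * x * b ∈ R.grp) :
    homMk a ha ≫ homMk b hb = homMk (a * b) (fun x hx => by
      simpa [mul_assoc] using hb _ (ha x hx)) := by
  apply hom_ext
  rw [toMap_homMk_one]
  exact congrArg (fun g => ((g * b : G) : G ⧸ R.grp)) (one_mul a)

theorem homMk_one (P : OrbitCat S) (h : ∀ x ∈ P.grp, 1⁻¹ * x * 1 ∈ P.grp) :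
    homMk 1 h = 𝟙 P := by
  apply hom_ext
  rw [toMap_homMk_one]
  rfl

theorem isIso_homMk {P Q : OrbitCat S} (a : G) (h : ∀ x ∈ P.grp, a⁻¹ * x * a ∈ Q.grp)
    (h' : ∀ x ∈ Q.grp, a * x * a⁻¹ ∈ P.grp) : IsIso (homMk a h) := by
  refine ⟨homMk a⁻¹ (by simpa using h'), ?_, ?_⟩
  · rw [homMk_comp, ← homMk_one P (by simp), homMk_eq_iff]
    simp
  · rw [homMk_comp, ← homMk_one Q (by simp), homMk_eq_iff]
    simp

/-- The trivial subgroup as an object of the orbit category. -/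
def botObj (S : Subgroup G) : OrbitCat S := ⟨⊥, bot_le⟩

/-- The morphism from the trivial subgroup determined by a group element. -/
def botHom (P : OrbitCat S) (a : G) : botObj S ⟶ P :=
  homMk a fun x hx => by
    rw [Subgroup.mem_bot.1 hx]
    simp [P.grp.one_mem]

theorem botHom_comp {P Q : OrbitCat S} (a b : G) (hb : ∀ x ∈ P.grp, b⁻¹ * x * b ∈ Q.grp) :
    botHom P a ≫ homMk b hb = botHom Q (a * b) :=
  homMk_comp _ _ _ _

theorem botHom_comp_botHom {Q : OrbitCat S} (a b : G) :
    botHom (botObj S) a ≫ botHom Q b = botHom Q (a * b) :=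
  homMk_comp _ _ _ _

theorem botHom_one : botHom (botObj S) 1 = 𝟙 _ := homMk_one _ _

end OrbitCat

/-! ### Spans of groups and the induced functors of orbit categories -/

theorem Sylow.exists_conj_mem {p : ℕ} [Fact p.Prime] {L : Type*} [Group L] [Finite L]
    (T : Sylow p L) {R : Subgroup L} (hR : IsPGroup p R) :
    ∃ l : L, ∀ r ∈ R, l * r * l⁻¹ ∈ T := by
  obtain ⟨T', hT'⟩ := hR.exists_le_sylow
  obtain ⟨l, rfl⟩ := MulAction.exists_smul_eq L T' T
  refine ⟨l, fun r hr => ?_⟩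
  rw [← MulAut.conj_apply]
  exact Subgroup.smul_mem_pointwise_smul _ _ _ (hT' hr)

/-- A homomorphism `ι : H → G` which is injective and `q : H → L` which is surjective, such that
`P ↦ ι (q⁻¹ P)` maps subgroups of `S'` to subgroups of `S`. -/
structure OrbitSpan {G L : Type u} [Group G] [Group L] (S : Subgroup G) (S' : Subgroup L)
    (H : Type u) [Group H] where
  ι : H →* G
  q : H →* L
  inj : Function.Injective ι
  surj : Function.Surjective q
  le : (S'.comap q).map ι ≤ S

namespace OrbitSpan

open OrbitCat

variable {G L H : Type u} [Group G] [Group L] [Group H] {S : Subgroup G} {S' : Subgroup L}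
  (σ : OrbitSpan S S' H)

def obj (P : OrbitCat S') : OrbitCat S :=
  ⟨(P.grp.comap σ.q).map σ.ι, (Subgroup.map_mono (Subgroup.comap_mono P.le)).trans σ.le⟩

theorem ι_mem_obj {P : OrbitCat S'} {h : H} : σ.ι h ∈ (σ.obj P).grp ↔ σ.q h ∈ P.grp :=
  ⟨fun ⟨h', hh', e⟩ => by rwa [← σ.inj e], fun hh => ⟨h, hh, rfl⟩⟩

theorem conj_mem_obj {P Q : OrbitCat S'} (h : H)
    (hh : ∀ x ∈ P.grp, (σ.q h)⁻¹ * x * σ.q h ∈ Q.grp) :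
    ∀ x ∈ (σ.obj P).grp, (σ.ι h)⁻¹ * x * σ.ι h ∈ (σ.obj Q).grp := by
  rintro _ ⟨k, hk, rfl⟩
  rw [← map_inv, ← map_mul, ← map_mul, ι_mem_obj]
  simpa using hh _ hk

/-- The functor `P ↦ ι (q⁻¹ P)` between orbit categories. -/
noncomputable def functor : OrbitCat S' ⥤ OrbitCat S where
  obj := σ.obj
  map {P Q} φ := homMk (σ.ι (Function.surjInv σ.surj (rep φ))) (σ.conj_mem_obj _ (by
    rw [Function.surjInv_eq σ.surj]
    exact rep_conj_mem φ))
  map_id P := by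
    rw [← homMk_one (σ.obj P) (by simp), homMk_eq_iff, ← map_inv, mul_one, ι_mem_obj, map_inv,
      Function.surjInv_eq σ.surj]
    have := homMk_eq_iff.1 ((homMk_rep (𝟙 P)).trans (homMk_one P (by simp)).symm)
    simpa using this
  map_comp {P Q R} φ ψ := by
    have h : (rep (φ ≫ ψ))⁻¹ * (rep φ * rep ψ) ∈ R.grp := by
      have := homMk_comp _ _ (rep_conj_mem φ) (rep_conj_mem ψ)
      rw [homMk_rep, homMk_rep] at this
      exact homMk_eq_iff.1 ((homMk_rep (φ ≫ ψ)).trans this)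
    rw [homMk_comp, homMk_eq_iff, ← map_mul, ← map_inv, ← map_mul, ι_mem_obj, map_mul, map_inv,
      map_mul]
    simpa only [Function.surjInv_eq σ.surj] using h

theorem ι_mem_functor_obj {P : OrbitCat S'} {h : H} :
    σ.ι h ∈ (σ.functor.obj P).grp ↔ σ.q h ∈ P.grp :=
  σ.ι_mem_obj

theorem conj_mem_functor_obj {P Q : OrbitCat S'} {h : H}
    (hh : ∀ x ∈ P.grp, (σ.q h)⁻¹ * x * σ.q h ∈ Q.grp) :
    ∀ x ∈ (σ.functor.obj P).grp, (σ.ι h)⁻¹ * x * σ.ι h ∈ (σ.functor.obj Q).grp :=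
  σ.conj_mem_obj h hh

theorem functor_map_homMk {P Q : OrbitCat S'} (h : H)
    (hh : ∀ x ∈ P.grp, (σ.q h)⁻¹ * x * σ.q h ∈ Q.grp) :
    σ.functor.map (homMk (σ.q h) hh) =
      homMk (P := σ.functor.obj P) (Q := σ.functor.obj Q) (σ.ι h)
        (σ.conj_mem_functor_obj hh) := by
  have h1 := rep_conj_mem (homMk (σ.q h) hh)
  have h2 : (rep (homMk (σ.q h) hh))⁻¹ * σ.q h ∈ Q.grp := homMk_eq_iff.1 (homMk_rep _)
  refine (homMk_eq_iff (ha := σ.conj_mem_obj _ ?_) (hb := σ.conj_mem_obj _ ?_)).2 ?_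
  · rwa [Function.surjInv_eq σ.surj]
  · exact hh
  · rw [← map_inv, ← map_mul, ι_mem_obj, map_mul, map_inv]
    rwa [Function.surjInv_eq σ.surj]

/-- Morphisms from the image of `d` to `x` are the points of `G/x` fixed by `ι(q⁻¹ d)`, that is, the
`d`-fixed points of the `L`-set `(G/x)^{ker q}`. Splitting that `L`-set into orbits gives the
representables; the orbits are the double cosets `H \ X / x`, with `X` the elements defining a point
fixed by `ker q`. -/
theorem homsAreCoproducts {p : ℕ} [Fact p.Prime] [Finite L] (hS : IsPGroup p S)
    {T : Sylow p L} (σ : OrbitSpan S (T : Subgroup L) H) : HomsAreCoproducts σ.functor := by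
  intro x
  let X := {a : G // ∀ k, σ.q k = 1 → a⁻¹ * σ.ι k * a ∈ x.grp}
  let s : Setoid X :=
    { r := fun a b => ∃ h, a.1⁻¹ * σ.ι h * b.1 ∈ x.grp
      iseqv :=
        { refl := fun a => ⟨1, by simp [x.grp.one_mem]⟩
          symm := fun {a b} ⟨h, hh⟩ => ⟨h⁻¹, by
            rw [← inv_mem_iff]
            simpa [mul_assoc] using hh⟩
          trans := fun {a b c} ⟨h, hh⟩ ⟨h', hh'⟩ => ⟨h * h', by
            have := mul_mem hh hh'
            simpa [mul_assoc] using this⟩ } }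
  -- The stabilizer of a point is a `p`-group, but it lies in the given Sylow subgroup only after
  -- the representative is moved within its orbit.
  have key : ∀ o : Quotient s, ∃ a : X, Quotient.mk s a = o ∧
      ∀ h, a.1⁻¹ * σ.ι h * a.1 ∈ x.grp → σ.q h ∈ T := by
    rintro ⟨a⟩
    let R : Subgroup H := x.grp.comap ((MulAut.conj a.1⁻¹).toMonoidHom.comp σ.ι)
    have hR : IsPGroup p R := by
      refine IsPGroup.comap_of_injective (hS.to_le x.le) _ ?_
      exact (MulAut.conj a.1⁻¹).injective.comp σ.inj
    obtain ⟨l, hl⟩ := T.exists_conj_mem (hR.map σ.q)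
    obtain ⟨h, rfl⟩ := σ.surj l
    refine ⟨⟨σ.ι h * a.1, fun k hk => ?_⟩, ?_, fun k hk => ?_⟩
    · have := a.2 (h⁻¹ * k * h) (by simp [hk])
      simpa [mul_assoc] using this
    · refine Quotient.sound ⟨h, ?_⟩
      simp [x.grp.one_mem]
    · have := hl _ ⟨h⁻¹ * k * h, ?_, rfl⟩
      · simpa [mul_assoc] using this
      · change a.1⁻¹ * σ.ι (h⁻¹ * k * h) * a.1⁻¹⁻¹ ∈ x.grp
        simpa [mul_assoc] using hk
  choose r hr hrT using key
  let c : Quotient s → OrbitCat (T : Subgroup L) := fun o =>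
    ⟨(x.grp.comap ((MulAut.conj (r o).1⁻¹).toMonoidHom.comp σ.ι)).map σ.q, by
      rintro _ ⟨h, hh, rfl⟩
      refine hrT o h ?_
      change (r o).1⁻¹ * σ.ι h * (r o).1⁻¹⁻¹ ∈ x.grp at hh
      rwa [inv_inv] at hh⟩
  have hc : ∀ o h, σ.q h ∈ (c o).grp ↔ (r o).1⁻¹ * σ.ι h * (r o).1 ∈ x.grp := by
    intro o h
    constructor
    · rintro ⟨k, hk, hkh⟩
      change (r o).1⁻¹ * σ.ι k * (r o).1⁻¹⁻¹ ∈ x.grp at hk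
      have := mul_mem hk ((r o).2 (k⁻¹ * h) (by simp [hkh]))
      simpa [mul_assoc] using this
    · intro hh
      refine ⟨h, ?_, rfl⟩
      change (r o).1⁻¹ * σ.ι h * (r o).1⁻¹⁻¹ ∈ x.grp
      rwa [inv_inv]
  refine ⟨Quotient s, c, fun o => homMk (r o).1 ?_, ?_⟩
  · rintro _ ⟨h, hh, rfl⟩
    exact (hc o h).1 hh
  intro d v
  obtain ⟨b, hb, rfl⟩ := exists_eq_homMk v
  have hbX : ∀ k, σ.q k = 1 → b⁻¹ * σ.ι k * b ∈ x.grp := fun k hk =>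
    hb _ ⟨k, by simp [hk, d.grp.one_mem], rfl⟩
  let o : Quotient s := Quotient.mk s ⟨b, hbX⟩
  obtain ⟨h, hh⟩ : ∃ h, (r o).1⁻¹ * σ.ι h * b ∈ x.grp := Quotient.exact (hr o)
  have hf : ∀ l ∈ d.grp, (σ.q h⁻¹)⁻¹ * l * σ.q h⁻¹ ∈ (c o).grp := by
    intro l hl
    obtain ⟨m, rfl⟩ := σ.surj l
    rw [← map_inv, ← map_mul, ← map_mul, hc]
    have := mul_mem (mul_mem hh (hb _ ⟨m, hl, rfl⟩)) (inv_mem hh)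
    simpa [mul_assoc] using this
  refine ⟨⟨o, homMk (σ.q h⁻¹) hf⟩, ?_, ?_⟩
  · change σ.functor.map (homMk (σ.q h⁻¹) hf) ≫ homMk (r o).1 _ = _
    rw [functor_map_homMk, homMk_comp, homMk_eq_iff]
    simpa [mul_assoc] using hh
  · rintro ⟨o', f'⟩ hf'
    obtain ⟨l', hl', rfl⟩ := exists_eq_homMk f'
    obtain ⟨h', rfl⟩ := σ.surj l'
    change σ.functor.map (homMk (σ.q h') hl') ≫ homMk (r o').1 _ = _ at hf'
    rw [functor_map_homMk, homMk_comp, homMk_eq_iff] at hf'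
    have ho : o' = o := by
      rw [← hr o']
      refine Quotient.sound ⟨h'⁻¹, ?_⟩
      simpa [mul_assoc] using hf'
    subst ho
    congr 1
    rw [homMk_eq_iff, ← map_inv, ← map_mul, hc]
    have := mul_mem hf' (inv_mem hh)
    simpa [mul_assoc] using this

/-- Every span can be conjugated so that it is compatible with given Sylow subgroups. -/
theorem exists_conj {p : ℕ} [Fact p.Prime] [Finite G] [Finite L] (T : Sylow p G) (T' : Sylow p L)
    (ι : H →* G) (q : H →* L) (hι : Function.Injective ι) (hq : Function.Surjective q)
    (hk : IsPGroup p q.ker) :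
    ∃ (g : G) (σ : OrbitSpan (T : Subgroup G) (T' : Subgroup L) H),
      (∀ h, σ.ι h = g * ι h * g⁻¹) ∧ σ.q = q := by
  obtain ⟨g, hg⟩ := T.exists_conj_mem
    ((T'.2.comap_of_ker_isPGroup q hk).map ι)
  refine ⟨g, ⟨(MulAut.conj g).toMonoidHom.comp ι, q, (MulAut.conj g).injective.comp hι, hq, ?_⟩,
    fun h => rfl, rfl⟩
  rintro _ ⟨h, hh, rfl⟩
  exact hg _ ⟨h, hh, rfl⟩

theorem mem_functor_bot {x : G} :
    x ∈ (σ.functor.obj (botObj S')).grp ↔ ∃ h, σ.q h = 1 ∧ σ.ι h = x :=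
  Iff.rfl

/-- The morphism out of the image of the trivial subgroup determined by a group element. -/
noncomputable def fromBot (P : OrbitCat S) (a : G) (ha : ∀ h, σ.q h = 1 → a⁻¹ * σ.ι h * a ∈ P.grp) :
    σ.functor.obj (botObj S') ⟶ P :=
  homMk a (by
    rintro _ ⟨h, hh, rfl⟩
    exact ha h hh)

theorem exists_eq_fromBot {P : OrbitCat S} (φ : σ.functor.obj (botObj S') ⟶ P) :
    ∃ a ha, φ = σ.fromBot P a ha := by
  obtain ⟨a, ha, rfl⟩ := exists_eq_homMk φ
  exact ⟨a, fun h hh => ha _ ⟨h, hh, rfl⟩, rfl⟩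

theorem fromBot_eq_iff {P : OrbitCat S} {a b : G} {ha hb} :
    σ.fromBot P a ha = σ.fromBot P b hb ↔ a⁻¹ * b ∈ P.grp :=
  homMk_eq_iff

theorem functor_map_botHom {Q : OrbitCat S'} {l : L} {h : H} (hl : σ.q h = l) :
    σ.functor.map (botHom Q l) = σ.fromBot (σ.functor.obj Q) (σ.ι h) (fun k hk => by
      rw [← map_inv, ← map_mul, ← map_mul, ι_mem_functor_obj]
      simp [hk, Q.grp.one_mem]) := by
  subst hl
  exact σ.functor_map_homMk h _

theorem functor_map_botHom_comp {Q : OrbitCat S'} {l : L} {h : H} (hl : σ.q h = l)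
    {P : OrbitCat S} {a : G} (ha : ∀ x ∈ (σ.functor.obj Q).grp, a⁻¹ * x * a ∈ P.grp) :
    σ.functor.map (botHom Q l) ≫ homMk a ha = σ.fromBot P (σ.ι h * a) (fun k hk => by
      have := ha (σ.ι (h⁻¹ * k * h)) (by
        rw [ι_mem_functor_obj]
        simp [hk, Q.grp.one_mem])
      simpa [mul_assoc] using this) := by
  rw [functor_map_botHom σ hl]
  exact homMk_comp _ _ _ _

theorem functor_map_botHom_comp_fromBot {l : L} {h : H} (hl : σ.q h = l)
    {P : OrbitCat S} {a : G} (ha : ∀ h, σ.q h = 1 → a⁻¹ * σ.ι h * a ∈ P.grp) :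
    σ.functor.map (botHom (botObj S') l) ≫ σ.fromBot P a ha =
      σ.fromBot P (σ.ι h * a) (fun k hk => by
        simpa [mul_assoc] using ha (h⁻¹ * k * h) (by simp [hk])) :=
  σ.functor_map_botHom_comp hl _

end OrbitSpan

/-! ### Pointwise description of short exact sequences of presheaves -/

section ShortExactPresheaves

variable {C : Type u} [SmallCategory C]

section

variable {S : ShortComplex (Cᵒᵖ ⥤ AddCommGrpCat.{u})} (hS : S.ShortExact)

include hS

theorem CategoryTheory.ShortComplex.ShortExact.evaluation (c : Cᵒᵖ) :
    (S.map ((evaluation _ _).obj c)).ShortExact :=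
  hS.map_of_exact _

theorem CategoryTheory.ShortComplex.ShortExact.app_surjective (c : Cᵒᵖ) :
    Function.Surjective (S.g.app c) :=
  (hS.evaluation c).ab_surjective_g

theorem CategoryTheory.ShortComplex.ShortExact.app_eq_zero_iff (c : Cᵒᵖ) (y : S.X₂.obj c) :
    S.g.app c y = 0 ↔ ∃ x, S.f.app c x = y := by
  constructor
  · exact (ShortComplex.ab_exact_iff _).1 (hS.evaluation c).exact y
  · rintro ⟨x, rfl⟩
    have := congrArg (fun α => α.app c) S.zero
    exact ConcreteCategory.congr_hom this x

end

/-- The short exact sequence attached to a monomorphism of presheaves. -/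
noncomputable abbrev cokernelSequence {F E : Cᵒᵖ ⥤ AddCommGrpCat.{u}} (i : F ⟶ E) :
    ShortComplex (Cᵒᵖ ⥤ AddCommGrpCat.{u}) :=
  ShortComplex.mk i (cokernel.π i) (cokernel.condition i)

theorem cokernelSequence_shortExact {F E : Cᵒᵖ ⥤ AddCommGrpCat.{u}} (i : F ⟶ E) [Mono i] :
    (cokernelSequence i).ShortExact where
  exact := ShortComplex.exact_of_g_is_cokernel _ (cokernelIsCokernel i)
  mono_f := ‹_›
  epi_g := inferInstanceAs (Epi (cokernel.π i))

theorem presheaf_mono_of_injective {F E : Cᵒᵖ ⥤ AddCommGrpCat.{u}} (i : F ⟶ E)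
    (h : ∀ c, Function.Injective (i.app c)) : Mono i := by
  rw [NatTrans.mono_iff_mono_app]
  exact fun c => (AddCommGrpCat.mono_iff_injective _).2 (h c)

theorem presheaf_isIso_of_bijective {F E : Cᵒᵖ ⥤ AddCommGrpCat.{u}} (i : F ⟶ E)
    (h : ∀ c, Function.Bijective (i.app c)) : IsIso i := by
  have : ∀ c, IsIso (i.app c) := fun c => (ConcreteCategory.isIso_iff_bijective _).2 (h c)
  exact NatIso.isIso_of_isIso_app i

end ShortExactPresheaves

/-! ### Subfunctors of fixed-point functors -/

section FixedFamilies

open OrbitCat Opposite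

variable {k : Type*} [Semiring k] {G : Type u} [Group G] {M : Type u} [AddCommGroup M]
  [Module k M] (ρ : Representation k G M) (S : Subgroup G)

/-- A subfunctor of the fixed point functor of a `G`-module on an orbit category. -/
structure FixedFamily where
  sub : OrbitCat S → AddSubgroup M
  fixed : ∀ ⦃P m⦄, m ∈ sub P → ∀ x ∈ P.grp, ρ x m = m
  conj : ∀ ⦃P Q : OrbitCat S⦄ ⦃a : G⦄, (∀ x ∈ P.grp, a⁻¹ * x * a ∈ Q.grp) →
    ∀ ⦃m⦄, m ∈ sub Q → ρ a m ∈ sub P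

variable {ρ S}

namespace FixedFamily

theorem apply_eq (A : FixedFamily ρ S) {P : OrbitCat S} {m : M} (hm : m ∈ A.sub P) {a b : G}
    (h : a⁻¹ * b ∈ P.grp) : ρ b m = ρ a m := by
  conv_rhs => rw [← A.fixed hm _ h]
  rw [← Module.End.mul_apply, ← map_mul, mul_inv_cancel_left]

/-- The presheaf defined by a family of subgroups of fixed points. -/
noncomputable def presheaf (A : FixedFamily ρ S) : (OrbitCat S)ᵒᵖ ⥤ AddCommGrpCat.{u} where
  obj P := AddCommGrpCat.of (A.sub P.unop)
  map φ := AddCommGrpCat.ofHom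
    { toFun m := ⟨ρ (rep φ.unop) m.1, A.conj (rep_conj_mem φ.unop) m.2⟩
      map_zero' := by ext; simp
      map_add' x y := by ext; simp }
  map_id P := by
    ext m
    change ρ (rep (𝟙 P.unop)) m.1 = m.1
    refine A.fixed m.2 _ ?_
    have := homMk_eq_iff.1 ((homMk_rep (𝟙 P.unop)).trans (homMk_one P.unop (by simp)).symm)
    simpa using this
  map_comp {P Q R} φ ψ := by
    ext m
    change ρ (rep (ψ.unop ≫ φ.unop)) m.1 = ρ (rep ψ.unop) (ρ (rep φ.unop) m.1)
    rw [← Module.End.mul_apply, ← map_mul]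
    refine (A.apply_eq m.2 ?_)
    have := homMk_comp _ _ (rep_conj_mem ψ.unop) (rep_conj_mem φ.unop)
    rw [homMk_rep, homMk_rep] at this
    exact homMk_eq_iff.1 (this.symm.trans (homMk_rep _).symm)

/-- The inclusion of the values of the presheaf in the module. -/
noncomputable def val (A : FixedFamily ρ S) (P : OrbitCat S) : A.presheaf.obj (op P) →+ M :=
  (A.sub P).subtype

theorem val_injective (A : FixedFamily ρ S) (P : OrbitCat S) : Function.Injective (A.val P) :=
  Subtype.val_injective

theorem val_mem (A : FixedFamily ρ S) {P : OrbitCat S} (m : A.presheaf.obj (op P)) :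
    A.val P m ∈ A.sub P := m.2

/-- An element of the value of the presheaf. -/
def elem (A : FixedFamily ρ S) {P : OrbitCat S} (m : M) (hm : m ∈ A.sub P) :
    A.presheaf.obj (op P) := (⟨m, hm⟩ : A.sub P)

theorem val_map_homMk (A : FixedFamily ρ S) {P Q : OrbitCat S} (a : G)
    (h : ∀ x ∈ P.grp, a⁻¹ * x * a ∈ Q.grp) (m : A.presheaf.obj (op Q)) :
    A.val P (A.presheaf.map (homMk a h).op m) = ρ a (A.val Q m) :=
  A.apply_eq m.2 (homMk_eq_iff.1 (homMk_rep (homMk a h)).symm)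

theorem val_map_functor_botHom {L H : Type u} [Group L] [Group H] {S' : Subgroup L}
    (σ : OrbitSpan S S' H) (A : FixedFamily ρ S) {Q : OrbitCat S'} {l : L} {h : H} (hl : σ.q h = l)
    (m : A.presheaf.obj (op (σ.functor.obj Q))) :
    A.val _ (A.presheaf.map (σ.functor.map (botHom Q l)).op m) = ρ (σ.ι h) (A.val _ m) := by
  rw [σ.functor_map_botHom hl]
  exact A.val_map_homMk _ _ _

variable (ρ S) in
/-- The family with value `M` at the trivial subgroup and zero elsewhere. -/
noncomputable def atomic : FixedFamily ρ S where
  sub P := atomicObj M P.grp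
  fixed P m hm x hx := by
    by_cases h : P.grp = ⊥
    · rw [h, Subgroup.mem_bot] at hx
      rw [hx, map_one, Module.End.one_apply]
    · rw [mem_atomicObj.1 hm h, map_zero]
  conj P Q a h m hm := by
    rw [mem_atomicObj] at hm ⊢
    intro hP
    rw [hm fun hQ => hP ?_, map_zero]
    rw [Subgroup.eq_bot_iff_forall]
    intro x hx
    have := h x hx
    rw [hQ, Subgroup.mem_bot] at this
    simpa using conj_eq_one_iff.1 (show a⁻¹ * x * a⁻¹⁻¹ = 1 by simpa using this)

/-- The inclusion of presheaves attached to an inclusion of families. -/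
noncomputable def incl {A B : FixedFamily ρ S} (h : ∀ P, A.sub P ≤ B.sub P) :
    A.presheaf ⟶ B.presheaf where
  app P := AddCommGrpCat.ofHom (AddSubgroup.inclusion (h P.unop))
  naturality _ _ _ := rfl

instance {A B : FixedFamily ρ S} (h : ∀ P, A.sub P ≤ B.sub P) : Mono (incl h) :=
  presheaf_mono_of_injective _ fun P => AddSubgroup.inclusion_injective (h P.unop)

variable (ρ S) in
/-- The fixed points under those subgroups `P` which intersect the normal subgroup `K` trivially,
and zero on all other subgroups. -/
def fixedOff (K : Subgroup G) [K.Normal] : FixedFamily ρ S where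
  sub P :=
    { carrier := {m | (∀ x ∈ P.grp, ρ x m = m) ∧ ∀ x ∈ P.grp, x ∈ K → x ≠ 1 → m = 0}
      zero_mem' := ⟨fun _ _ => map_zero _, fun _ _ _ _ => rfl⟩
      add_mem' := fun {a b} ha hb => ⟨fun x hx => by rw [map_add, ha.1 x hx, hb.1 x hx],
        fun x hx hK h1 => by rw [ha.2 x hx hK h1, hb.2 x hx hK h1, add_zero]⟩
      neg_mem' := fun {a} ha => ⟨fun x hx => by rw [map_neg, ha.1 x hx],
        fun x hx hK h1 => by rw [ha.2 x hx hK h1, neg_zero]⟩ }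
  fixed P m hm := hm.1
  conj P Q a h m hm := by
    refine ⟨fun x hx => ?_, fun x hx hK h1 => ?_⟩
    · conv_rhs => rw [← hm.1 _ (h x hx)]
      rw [← Module.End.mul_apply, ← map_mul, ← Module.End.mul_apply, ← map_mul]
      congr 2
      group
    · rw [hm.2 _ (h x hx) (by simpa using ‹K.Normal›.conj_mem x hK a⁻¹), map_zero]
      intro h2
      refine h1 (by simpa using conj_eq_one_iff.1 (show a⁻¹ * x * a⁻¹⁻¹ = 1 by simpa using h2))

theorem atomic_le_fixedOff (K : Subgroup G) [K.Normal] (P : OrbitCat S) :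
    (atomic ρ S).sub P ≤ (fixedOff ρ S K).sub P := fun m hm =>
  ⟨(atomic ρ S).fixed hm, fun x hx _ h1 => mem_atomicObj.1 hm fun hP =>
    h1 (by rwa [hP, Subgroup.mem_bot] at hx)⟩

end FixedFamily

end FixedFamilies

/-! ### Transfer and acyclicity of fixed-point functors -/

section Transfer

/-- The permutation preserves each level set of `f`, and has no fixed point on those with nonzero
value. Being of `p`-power order, it forces the size of such a level set to be divisible by `p`. -/
theorem sum_eq_zero_of_perm {p n : ℕ} [Fact p.Prime] {Z M : Type*} [Fintype Z] [AddCommGroup M]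
    (hM : ∀ m : M, p • m = 0) (τ : Equiv.Perm Z) (hτ : τ ^ p ^ n = 1) (f : Z → M)
    (hf : ∀ z, f (τ z) = f z) (h0 : ∀ z, τ z = z → f z = 0) : ∑ z, f z = 0 := by
  classical
  rw [← Finset.sum_fiberwise_of_maps_to (t := Finset.univ.image f) (g := f)
    (fun z _ => Finset.mem_image_of_mem _ (Finset.mem_univ z))]
  refine Finset.sum_eq_zero fun m _ => ?_
  by_cases hm : m = 0
  · exact Finset.sum_eq_zero fun z hz => by rw [(Finset.mem_filter.1 hz).2, hm]
  rw [Finset.sum_congr rfl (fun z hz => (Finset.mem_filter.1 hz).2), Finset.sum_const]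
  suffices h : p ∣ (Finset.univ.filter fun z => f z = m).card by
    obtain ⟨c, hc⟩ := h
    rw [hc, mul_smul, hM]
  let τ' : Function.End {z // f z = m} := fun z => ⟨τ z.1, by rw [hf, z.2]⟩
  have hpow : ∀ j (z : {z // f z = m}), ((τ' ^ j) z).1 = (τ ^ j) z.1 := by
    intro j
    induction j with
    | zero => exact fun z => rfl
    | succ j ih =>
      intro z
      rw [pow_succ', pow_succ', Equiv.Perm.mul_apply, ← ih]
      rfl
  have h1 : τ' ^ p ^ n = 1 := funext fun z => Subtype.ext (by rw [hpow, hτ]; rfl)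
  have h2 := Equiv.Perm.card_fixedPoints_modEq h1
  have h3 : IsEmpty (Function.fixedPoints τ') := ⟨fun z => hm <| by
    rw [← z.1.2]
    exact h0 _ (congrArg Subtype.val z.2)⟩
  rw [Fintype.card_eq_zero (α := Function.fixedPoints τ')] at h2
  rw [← Fintype.card_subtype]
  exact (Nat.modEq_zero_iff_dvd).1 h2

end Transfer

section Transfer

theorem nsmul_bijective_of_coprime {A : Type*} [AddCommGroup A] {n p : ℕ} (h : n.Coprime p)
    (hA : ∀ a : A, p • a = 0) : Function.Bijective fun a : A => n • a := by
  have key : ∀ a : A, (n.gcdA p) • (n • a) = a := by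
    intro a
    have h1 := Nat.gcd_eq_gcd_ab n p
    rw [h, Nat.cast_one] at h1
    have h2 : (1 : ℤ) • a = ((n : ℤ) * n.gcdA p + p * n.gcdB p) • a := by rw [← h1]
    rw [one_smul, add_smul, mul_comm (p : ℤ), mul_smul, mul_smul, natCast_zsmul, natCast_zsmul, hA,
      smul_zero, add_zero] at h2
    rw [smul_comm]
    exact h2.symm
  refine ⟨fun a b hab => ?_, fun a => ⟨n.gcdA p • a, ?_⟩⟩
  · rw [← key a, ← key b]
    exact congrArg _ hab
  · rw [← key a]
    exact (smul_comm _ _ _).trans (by rw [key])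

open OrbitCat Opposite FixedFamily

variable {G : Type u} [Group G]

/-- The span which relates the orbit category of a `p`-group `S` to an orbit category of an
ambient group. -/
noncomputable def OrbitSpan.ofSubgroup {p : ℕ} (S : Subgroup G) (T : Sylow p S) :
    OrbitSpan S (T : Subgroup S) S where
  ι := S.subtype
  q := MonoidHom.id _
  inj := S.subtype_injective
  surj := Function.surjective_id
  le := by
    rintro _ ⟨x, _, rfl⟩
    exact x.2

theorem IsPGroup.sylow_eq_top {p : ℕ} {S : Type*} [Group S] (hS : IsPGroup p S) (T : Sylow p S) :
    (T : Subgroup S) = ⊤ :=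
  T.3 (hS.to_subgroup ⊤) le_top |>.symm

/-- The orbit category of a `p`-group has a terminal object. -/
noncomputable def OrbitCat.isTerminalTop {S : Subgroup G} (hS : S = ⊤) :
    IsTerminal (⟨⊤, hS.ge⟩ : OrbitCat S) :=
  IsTerminal.ofUniqueHom (fun P => homMk 1 fun _ _ => Subgroup.mem_top _) fun P φ => by
    obtain ⟨a, ha, rfl⟩ := exists_eq_homMk φ
    rw [homMk_eq_iff]
    exact Subgroup.mem_top _

variable {k : Type*} [Semiring k] {M : Type u} [AddCommGroup M]
  [Module k M] (ρ : Representation k G M) {p : ℕ} (T : Sylow p G)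
  (T' : Sylow p T) (hM : ∀ m : M, p • m = 0) (K : Subgroup G) [K.Normal]
  (hK : ∀ x ∈ K, ρ x = 1)

local notation "𝓕" => FixedFamily.fixedOff ρ (T : Subgroup G) K
local notation "τ" => OrbitSpan.ofSubgroup (T : Subgroup G) T'

theorem OrbitSpan.ofSubgroup_conj_mem (P : OrbitCat (T : Subgroup G)) (a : G) (h : T)
    (hh : (τ).q h = 1) : a⁻¹ * (τ).ι h * a ∈ P.grp := by
  change h = 1 at hh
  rw [hh, map_one]
  simp [P.grp.one_mem]

variable {T T'}

/-- The summands of the transfer. -/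
noncomputable def transferTerm {P : OrbitCat (T : Subgroup G)}
    (s : ((coind (τ).functor).obj ((presheafRes (τ).functor).obj (𝓕).presheaf)).obj (op P))
    (g : G) : M :=
  ρ g ((𝓕).val ((τ).functor.obj (botObj _)) (coindVal (τ).functor _ (botObj _)
    ((τ).fromBot P g⁻¹ (OrbitSpan.ofSubgroup_conj_mem _ _ P g⁻¹)) s))

variable {ρ K}

/-- The term depends only on the coset `gT`, so the transfer can be summed over `G/T`. -/
theorem transferTerm_mul {P : OrbitCat (T : Subgroup G)}
    (s : ((coind (τ).functor).obj ((presheafRes (τ).functor).obj (𝓕).presheaf)).obj (op P))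
    (g : G) (t : T) :
    transferTerm ρ K s (g * t) = transferTerm ρ K s g := by
  have h0 : (τ).fromBot P (g * t)⁻¹ (OrbitSpan.ofSubgroup_conj_mem _ _ P _) =
      (τ).functor.map (botHom (botObj _) t⁻¹) ≫
        (τ).fromBot P g⁻¹ (OrbitSpan.ofSubgroup_conj_mem _ _ P _) := by
    rw [(τ).functor_map_botHom_comp_fromBot (l := t⁻¹) (h := t⁻¹) rfl, OrbitSpan.fromBot_eq_iff]
    simp [OrbitSpan.ofSubgroup, P.grp.one_mem]
  rw [transferTerm, h0, ← map_coindVal, transferTerm]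
  refine (congrArg (ρ (g * t)) (val_map_functor_botHom (τ) (𝓕) (l := t⁻¹) (h := t⁻¹) rfl
    _)).trans ?_
  rw [← Module.End.mul_apply, ← map_mul]
  simp [OrbitSpan.ofSubgroup]

theorem transferTerm_smul {P : OrbitCat (T : Subgroup G)}
    (s : ((coind (τ).functor).obj ((presheafRes (τ).functor).obj (𝓕).presheaf)).obj (op P))
    (g : G) {x : G}
    (hx : x ∈ P.grp) :
    transferTerm ρ K s (x * g) = ρ x (transferTerm ρ K s g) := by
  have h0 : (τ).fromBot P (x * g)⁻¹ (OrbitSpan.ofSubgroup_conj_mem _ _ P _) =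
      (τ).fromBot P g⁻¹ (OrbitSpan.ofSubgroup_conj_mem _ _ P _) := by
    rw [OrbitSpan.fromBot_eq_iff]
    simpa using hx
  rw [transferTerm, transferTerm, h0, map_mul, Module.End.mul_apply]

/-- The component of `s` at `g⁻¹` is restricted from its component at the cyclic group generated by
`g⁻¹xg`. That group meets `K` nontrivially, so the presheaf is zero there. -/
theorem transferTerm_eq_zero [Fact p.Prime] {P : OrbitCat (T : Subgroup G)}
    (s : ((coind (τ).functor).obj ((presheafRes (τ).functor).obj (𝓕).presheaf)).obj (op P))
    (g : G) {x : G}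
    (hx : x ∈ P.grp) (hxK : x ∈ K) (h1 : x ≠ 1) (hg : g⁻¹ * x * g ∈ T) :
    transferTerm ρ K s g = 0 := by
  let t : T := ⟨g⁻¹ * x * g, hg⟩
  have hT' : Subgroup.zpowers t ≤ (T' : Subgroup T) := by
    rw [IsPGroup.sylow_eq_top T.2 T']
    exact le_top
  let c : OrbitCat (T' : Subgroup T) := ⟨Subgroup.zpowers t, hT'⟩
  have hw : ∀ y ∈ ((τ).functor.obj c).grp, g⁻¹⁻¹ * y * g⁻¹ ∈ P.grp := by
    rintro _ ⟨y, ⟨n, rfl⟩, rfl⟩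
    have : g⁻¹⁻¹ * ((t ^ n : T) : G) * g⁻¹ = x ^ n := by
      rw [SubgroupClass.coe_zpow, inv_inv, ← conj_zpow]
      simp [t, mul_assoc]
    exact this ▸ zpow_mem hx n
  have h0 : (τ).fromBot P g⁻¹ (OrbitSpan.ofSubgroup_conj_mem _ _ P _) =
      (τ).functor.map (botHom c 1) ≫ homMk g⁻¹ hw := by
    rw [(τ).functor_map_botHom_comp (l := 1) (h := 1) rfl, OrbitSpan.fromBot_eq_iff]
    simp [P.grp.one_mem]
  have h2 : coindVal (τ).functor _ c (homMk g⁻¹ hw) s = 0 := by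
    apply (𝓕).val_injective ((τ).functor.obj c)
    refine Eq.trans ?_ (map_zero _).symm
    refine ((𝓕).val_mem (coindVal (τ).functor _ c (homMk g⁻¹ hw) s)).2 (g⁻¹ * x * g)
      ⟨t, Subgroup.mem_zpowers t, rfl⟩ ?_ ?_
    · simpa using ‹K.Normal›.conj_mem x hxK g⁻¹
    · intro h
      exact h1 (conj_eq_one_iff.1 (show g⁻¹ * x * g⁻¹⁻¹ = 1 by simpa using h))
  rw [transferTerm, h0, ← map_coindVal, h2, map_zero]
  exact (congrArg _ (map_zero _)).trans (map_zero _)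

theorem transferTerm_out {P : OrbitCat (T : Subgroup G)}
    (s : ((coind (τ).functor).obj ((presheafRes (τ).functor).obj (𝓕).presheaf)).obj (op P))
    (g : G) :
    transferTerm ρ K s (Quotient.out (g : G ⧸ (T : Subgroup G))) = transferTerm ρ K s g := by
  obtain ⟨t, ht⟩ := QuotientGroup.mk_out_eq_mul (T : Subgroup G) g
  rw [ht, transferTerm_mul]

theorem transferTerm_map {P Q : OrbitCat (T : Subgroup G)} (a : G)
    (ha : ∀ x ∈ Q.grp, a⁻¹ * x * a ∈ P.grp)
    (s : ((coind (τ).functor).obj ((presheafRes (τ).functor).obj (𝓕).presheaf)).obj (op P))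
    (g : G) :
    transferTerm ρ K (((coind (τ).functor).obj ((presheafRes (τ).functor).obj (𝓕).presheaf)).map
      (homMk a ha).op s) g = ρ a (transferTerm ρ K s (a⁻¹ * g)) := by
  have h0 : (τ).fromBot Q g⁻¹ (OrbitSpan.ofSubgroup_conj_mem _ _ Q _) ≫ homMk a ha =
      (τ).fromBot P (a⁻¹ * g)⁻¹ (OrbitSpan.ofSubgroup_conj_mem _ _ P _) := by
    refine (homMk_comp _ _ _ _).trans (homMk_eq_iff.2 ?_)
    simp [P.grp.one_mem]
  rw [transferTerm, transferTerm, ← h0, coindVal_map, ← Module.End.mul_apply, ← map_mul,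
    mul_inv_cancel_left]

section Finite

variable [Fintype (G ⧸ (T : Subgroup G))] [Fact p.Prime]

include hM hK in
-- Invariance under `P` is a reindexing of the cosets. If a nontrivial `x` lies in `P ∩ K`, its
-- action on cosets does not change the terms, since `K` acts trivially on `M`; the terms at fixed
-- cosets vanish and the other cosets cancel modulo `p`.
theorem transfer_mem {P : OrbitCat (T : Subgroup G)}
    (s : ((coind (τ).functor).obj ((presheafRes (τ).functor).obj (𝓕).presheaf)).obj (op P)) :
    ∑ z : G ⧸ (T : Subgroup G), transferTerm ρ K s z.out ∈ (𝓕).sub P := by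
  have hsmul : ∀ (x : G) (z : G ⧸ (T : Subgroup G)), x ∈ P.grp →
      transferTerm ρ K s (x • z).out = ρ x (transferTerm ρ K s z.out) := by
    intro x z hx
    induction z using QuotientGroup.induction_on with
    | H g => rw [MulAction.Quotient.smul_coe, smul_eq_mul, transferTerm_out, transferTerm_out,
        transferTerm_smul s g hx]
  refine ⟨fun x hx => ?_, fun x hx hxK h1 => ?_⟩
  · rw [map_sum]
    conv_rhs => rw [← Equiv.sum_comp (MulAction.toPerm x)]
    exact Finset.sum_congr rfl fun z _ => (hsmul x z hx).symm
  · obtain ⟨n, hn⟩ := T.2.to_le P.le ⟨x, hx⟩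
    refine sum_eq_zero_of_perm hM (n := n) (MulAction.toPermHom G (G ⧸ (T : Subgroup G)) x) ?_ _
      (fun z => ?_) fun z hz => ?_
    · rw [← map_pow]
      have : x ^ p ^ n = 1 := congrArg Subtype.val hn
      rw [this, map_one]
    · rw [MulAction.toPermHom_apply, MulAction.toPerm_apply, hsmul x z hx, hK x hxK,
        Module.End.one_apply]
    · induction z using QuotientGroup.induction_on with
      | H g =>
        rw [transferTerm_out]
        refine transferTerm_eq_zero s g hx hxK h1 ?_
        change ((x * g : G) : G ⧸ (T : Subgroup G)) = g at hz
        rw [eq_comm, QuotientGroup.eq, ← mul_assoc] at hz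
        exact hz

variable (T T')

/-- The transfer, a natural retraction up to the index of a Sylow subgroup. -/
noncomputable def transfer :
    (coind (τ).functor).obj ((presheafRes (τ).functor).obj (𝓕).presheaf) ⟶ (𝓕).presheaf where
  app P := AddCommGrpCat.ofHom
    { toFun s := (𝓕).elem _ (transfer_mem hM hK (P := P.unop) s)
      map_zero' := (𝓕).val_injective P.unop (Finset.sum_eq_zero fun z _ =>
        (congrArg _ ((congrArg _ (map_zero _)).trans (map_zero _))).trans (map_zero _))
      map_add' s t := (𝓕).val_injective P.unop ((Finset.sum_congr rfl fun z _ =>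
        (congrArg _ ((congrArg _ (map_add _ _ _)).trans (map_add _ _ _))).trans
          (map_add _ _ _)).trans Finset.sum_add_distrib) }
  naturality P Q φ := by
    ext s
    obtain ⟨a, ha, hφ⟩ := exists_eq_homMk φ.unop
    have hφ' : φ = (homMk a ha).op := by rw [← hφ]; rfl
    subst hφ'
    refine (𝓕).val_injective _ ?_
    refine Eq.trans ?_ ((𝓕).val_map_homMk a ha _).symm
    change ∑ z : G ⧸ (T : Subgroup G), transferTerm ρ K (((coind (τ).functor).obj
      ((presheafRes (τ).functor).obj (𝓕).presheaf)).map (homMk a ha).op s) z.out =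
      ρ a (∑ z : G ⧸ (T : Subgroup G), transferTerm ρ K s z.out)
    rw [map_sum, ← Equiv.sum_comp (MulAction.toPerm a)]
    refine Finset.sum_congr rfl fun z _ => ?_
    induction z using QuotientGroup.induction_on with
    | H g =>
      rw [MulAction.toPerm_apply, MulAction.Quotient.smul_coe, smul_eq_mul, transferTerm_out,
        transferTerm_out, transferTerm_map, inv_mul_cancel_left]

theorem transfer_unit {P : OrbitCat (T : Subgroup G)} (m : (𝓕).presheaf.obj (op P)) :
    (transfer T T' hM hK).app _ ((coindLift (τ).functor (𝟙 _)).app _ m) =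
      Fintype.card (G ⧸ (T : Subgroup G)) • m := by
  refine (𝓕).val_injective _ ?_
  rw [map_nsmul]
  change ∑ z : G ⧸ (T : Subgroup G), _ = _
  rw [← Finset.card_univ, ← Finset.sum_const]
  refine Finset.sum_congr rfl fun z _ => ?_
  refine (congrArg (ρ z.out) ((𝓕).val_map_homMk _ _ _)).trans ?_
  rw [← Module.End.mul_apply, ← map_mul, mul_inv_cancel, map_one, Module.End.one_apply]

/-- The composite is multiplication by the index of the Sylow subgroup, which is prime to `p`. -/
theorem isIso_unit_comp_transfer [Finite G] :
    IsIso (coindLift (τ).functor (𝟙 ((presheafRes (τ).functor).obj (𝓕).presheaf)) ≫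
      transfer T T' hM hK) := by
  refine presheaf_isIso_of_bijective _ fun P => ?_
  have hcop : (Fintype.card (G ⧸ (T : Subgroup G))).Coprime p := by
    rw [← Nat.card_eq_fintype_card, Nat.coprime_comm, (Fact.out : p.Prime).coprime_iff_not_dvd]
    exact T.not_dvd_index
  have htors : ∀ m : (𝓕).presheaf.obj P, p • m = 0 := fun m =>
    (𝓕).val_injective _ (by rw [map_nsmul, hM, map_zero])
  have happ : ∀ m : (𝓕).presheaf.obj P, (coindLift (τ).functor
      (𝟙 ((presheafRes (τ).functor).obj (𝓕).presheaf)) ≫ transfer T T' hM hK).app P m =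
      Fintype.card (G ⧸ (T : Subgroup G)) • m := fun m => transfer_unit T T' hM hK m
  rw [show ⇑(ConcreteCategory.hom ((coindLift (τ).functor
      (𝟙 ((presheafRes (τ).functor).obj (𝓕).presheaf)) ≫ transfer T T' hM hK).app P)) =
      fun m => Fintype.card (G ⧸ (T : Subgroup G)) • m from funext happ]
  exact nsmul_bijective_of_coprime hcop htors

end Finite

variable [Fact p.Prime] [Finite G]

include hM hK

theorem isZero_higherLim_succ_fixedOff (n : ℕ) :
    IsZero (higherLim (n + 1) (𝓕).presheaf) := by
  have := Fintype.ofFinite (G ⧸ (T : Subgroup G))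
  obtain ⟨T'⟩ : Nonempty (Sylow p T) := inferInstance
  let υ := OrbitSpan.ofSubgroup (T : Subgroup G) T'
  have := isIso_unit_comp_transfer T T' hM hK
  refine isZero_higherLim_of_retract (coindLift υ.functor (𝟙 _)) (transfer T T' hM hK) ?_
  obtain ⟨e⟩ := nonempty_higherLim_coind_iso (υ.homsAreCoproducts T.2) (n + 1)
    ((presheafRes υ.functor).obj (𝓕).presheaf)
  exact (isZero_higherLim_succ_of_isTerminal
    (isTerminalTop (IsPGroup.sylow_eq_top T.2 T')) _ n).of_iso e

/-- The presheaf is a retract of one coinduced from the orbit category of `T` itself, where `T` is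
terminal. The remaining limit in degree zero is the value at `T`, which is zero because `T` meets
`K`. -/
theorem higherLimsVanish_fixedOff (hT : ∃ x ∈ T, x ∈ K ∧ x ≠ 1) :
    HigherLimsVanish (𝓕).presheaf := by
  have := Fintype.ofFinite (G ⧸ (T : Subgroup G))
  obtain ⟨T'⟩ : Nonempty (Sylow p T) := inferInstance
  let υ := OrbitSpan.ofSubgroup (T : Subgroup G) T'
  have := isIso_unit_comp_transfer T T' hM hK
  intro n
  refine isZero_higherLim_of_retract (coindLift υ.functor (𝟙 _)) (transfer T T' hM hK) ?_
  refine HigherLimsVanish.coind (higherLimsVanish_of_isTerminal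
    (isTerminalTop (IsPGroup.sylow_eq_top T.2 T')) _ ?_) (υ.homsAreCoproducts T.2) n
  rw [AddCommGrpCat.isZero_iff_subsingleton]
  refine subsingleton_of_forall_eq 0 fun m => (𝓕).val_injective _ ?_
  obtain ⟨x, hxT, hxK, hx1⟩ := hT
  rw [map_zero]
  exact ((𝓕).val_mem m).2 x ⟨⟨x, hxT⟩, Subgroup.mem_top _, rfl⟩ hxK hx1

end Transfer

/-! ### Presheaves supported at the trivial subgroup -/

section AtBottom

open OrbitCat Opposite FixedFamily

variable {G : Type u} [Group G] {S : Subgroup G}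

theorem OrbitCat.eq_botObj {P : OrbitCat S} (h : P.grp = ⊥) : P = botObj S :=
  OrbitCat.ext h

/-- The action of the group on the value of a presheaf at the trivial subgroup. -/
noncomputable def botRep (F : (OrbitCat S)ᵒᵖ ⥤ AddCommGrpCat.{u}) :
    Representation ℤ G (F.obj (op (botObj S))) where
  toFun a := (F.map (botHom (botObj S) a).op).hom.toIntLinearMap
  map_one' := by
    ext m
    change F.map (botHom (botObj S) 1).op m = m
    rw [botHom_one, op_id, F.map_id]
    rfl
  map_mul' a b := by
    ext m
    change F.map (botHom (botObj S) (a * b)).op m =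
      F.map (botHom (botObj S) a).op (F.map (botHom (botObj S) b).op m)
    rw [← botHom_comp_botHom, op_comp, F.map_comp]
    rfl

/-- A presheaf which vanishes away from the trivial subgroup is determined by its value there. -/
theorem nonempty_iso_atomicFunctor {k : Type*} [Semiring k] {M : Type u} [AddCommGroup M]
    [Module k M] (ρ : Representation k G M) (F : (OrbitCat S)ᵒᵖ ⥤ AddCommGrpCat.{u})
    (hF : ∀ P : OrbitCat S, P.grp ≠ ⊥ → Subsingleton (F.obj (op P)))
    (e : F.obj (op (botObj S)) ≃+ M)
    (he : ∀ a m, e (F.map (botHom (botObj S) a).op m) = ρ a (e m)) :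
    Nonempty (F ≅ atomicFunctor ρ S) := by
  have hmem : ∀ (P : OrbitCat S) (m : F.obj (op P)),
      e (F.map (botHom P 1).op m) ∈ (atomic ρ S).sub P := fun P m =>
    mem_atomicObj.2 fun hP => by
      have := hF P hP
      rw [Subsingleton.elim m 0, map_zero, map_zero]
  let α : F ⟶ (atomic ρ S).presheaf :=
    { app := fun P => AddCommGrpCat.ofHom
        { toFun := fun m => (atomic ρ S).elem _ (hmem P.unop m)
          map_zero' := (atomic ρ S).val_injective P.unop
            ((congrArg e (map_zero _)).trans (map_zero e))
          map_add' := fun m n => (atomic ρ S).val_injective P.unop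
            ((congrArg e (map_add _ _ _)).trans (map_add e _ _)) }
      naturality := fun P Q φ => by
        ext m
        obtain ⟨a, ha, hφ⟩ := exists_eq_homMk φ.unop
        have hφ' : φ = (homMk a ha).op := by rw [← hφ]; rfl
        subst hφ'
        refine (atomic ρ S).val_injective _ ?_
        refine Eq.trans ?_ ((atomic ρ S).val_map_homMk a ha _).symm
        change e (F.map (botHom Q.unop 1).op (F.map (homMk a ha).op m)) =
          ρ a (e (F.map (botHom P.unop 1).op m))
        rw [← he]
        have h1 : botHom Q.unop 1 ≫ homMk a ha =
            botHom (botObj S) a ≫ botHom P.unop 1 := by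
          rw [botHom_comp, botHom_comp_botHom, one_mul, mul_one]
        have h2 := congrArg (fun f => F.map f.op m) h1
        simp only [op_comp, F.map_comp] at h2
        exact congrArg e h2 }
  have : IsIso α := by
    refine presheaf_isIso_of_bijective α fun P => ?_
    by_cases hP : P.unop.grp = ⊥
    · obtain rfl : P = op (botObj S) := congrArg op (eq_botObj hP)
      have hα : ∀ m, (atomic ρ S).val _ (α.app (op (botObj S)) m) = e m := by
        intro m
        change e (F.map (botHom (botObj S) 1).op m) = e m
        rw [botHom_one, op_id, F.map_id]
        rfl
      refine ⟨fun m n h => e.injective ?_, fun n => ⟨e.symm ((atomic ρ S).val _ n), ?_⟩⟩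
      · rw [← hα, ← hα, h]
      · apply (atomic ρ S).val_injective
        rw [hα, AddEquiv.apply_symm_apply]
    · have := hF P.unop hP
      refine ⟨fun m n _ => Subsingleton.elim (α := F.obj (op P.unop)) m n,
        fun n => ⟨0, (atomic ρ S).val_injective P.unop ?_⟩⟩
      exact (mem_atomicObj.1 ((atomic ρ S).val_mem _) hP).trans
        (mem_atomicObj.1 ((atomic ρ S).val_mem n) hP).symm
  exact ⟨(asIso α : F ≅ (atomic ρ S).presheaf)⟩

end AtBottom

/-! ### Presheaves concentrated on one conjugacy class -/

section Concentrated

open OrbitCat Opposite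

theorem Subgroup.conj_mem_of_conj_le {G : Type*} [Group G] [Finite G] {C : Subgroup G} {g : G}
    (h : ∀ x ∈ C, g⁻¹ * x * g ∈ C) : ∀ x ∈ C, g * x * g⁻¹ ∈ C := by
  intro x hx
  let f : C → C := fun x => ⟨_, h x.1 x.2⟩
  have hf : Function.Injective f := fun x y hxy => by
    have := congrArg Subtype.val hxy
    simpa [f] using this
  obtain ⟨y, hy⟩ := Finite.surjective_of_injective hf ⟨x, hx⟩
  have : g⁻¹ * y.1 * g = x := congrArg Subtype.val hy
  rw [← this]
  simp [mul_assoc]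

/-- Normalizers grow in the nilpotent group `P`. -/
theorem IsPGroup.exists_normalizes {G : Type*} [Group G] [Finite G] {p : ℕ} [Fact p.Prime]
    {P C : Subgroup G} (hP : IsPGroup p P) (hC : C ≤ P) {x : G} (hx : x ∈ P) (hxC : x ∉ C) :
    ∃ y ∈ P, y ∉ C ∧ ∀ z ∈ C, y⁻¹ * z * y ∈ C := by
  have : Group.IsNilpotent P := hP.isNilpotent
  have h1 : C.subgroupOf P < ⊤ := by
    rw [lt_top_iff_ne_top, Ne, Subgroup.subgroupOf_eq_top]
    exact fun h => hxC (h hx)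
  obtain ⟨-, h2⟩ := Group.normalizerCondition_of_isNilpotent (G := P) _ h1
  rw [SetLike.not_le_iff_exists] at h2
  obtain ⟨y, hy, hyC⟩ := h2
  refine ⟨y, y.2, hyC, fun z hz => ?_⟩
  have := (Subgroup.mem_normalizer_iff.1 (inv_mem hy) ⟨z, hC hz⟩).1 hz
  rw [inv_inv] at this
  exact Subgroup.mem_subgroupOf.1 this

variable {p : ℕ} [Fact p.Prime] {G L H : Type u} [Group G] [Group L] [Group H] [Finite G]
  [Finite L] {S : Subgroup G} {T : Sylow p L} (σ : OrbitSpan S (T : Subgroup L) H)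
  (F : (OrbitCat S)ᵒᵖ ⥤ AddCommGrpCat.{u})
  (hF : ∀ P : OrbitCat S, Nontrivial (F.obj (op P)) →
    ∃ g : G, ∀ x, x ∈ P.grp ↔ g⁻¹ * x * g ∈ (σ.functor.obj (botObj _)).grp)
  (hN : ∀ g : G, (∀ x ∈ (σ.functor.obj (botObj _)).grp,
    g⁻¹ * x * g ∈ (σ.functor.obj (botObj _)).grp) → ∃ h, σ.ι h = g)

-- The image of `c` contains `C`, the image of the trivial subgroup. If it is also conjugate to `C`,
-- finiteness forces equality, and then `c` is trivial.
omit [Fact p.Prime] [Finite L] in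
include hF in
theorem OrbitSpan.eq_bot_of_nontrivial (c : OrbitCat (T : Subgroup L))
    (hc : Nontrivial (F.obj (op (σ.functor.obj c)))) : c = botObj _ := by
  obtain ⟨g, hg⟩ := hF _ hc
  apply eq_botObj
  rw [Subgroup.eq_bot_iff_forall]
  intro l hl
  obtain ⟨h, rfl⟩ := σ.surj l
  have h1 : ∀ x ∈ (σ.functor.obj (botObj _)).grp,
      g⁻¹ * x * g ∈ (σ.functor.obj (botObj _)).grp := by
    rintro _ ⟨k, hk, rfl⟩
    refine (hg _).1 (σ.ι_mem_functor_obj.2 ?_)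
    rw [show σ.q k = 1 from hk]
    exact one_mem _
  have h2 := (hg (σ.ι h)).1 (σ.ι_mem_functor_obj.2 hl)
  have h3 := Subgroup.conj_mem_of_conj_le h1 _ h2
  simp only [mul_assoc, mul_inv_cancel_left, mul_inv_cancel, mul_one] at h3
  exact σ.ι_mem_functor_obj.1 h3

include hF hN in
/-- A presheaf which is concentrated on the conjugacy class of the image of the trivial subgroup
is coinduced from its restriction. -/
theorem OrbitSpan.isIso_unit (hS : IsPGroup p S) :
    IsIso (coindLift σ.functor (𝟙 ((presheafRes σ.functor).obj F))) := by
  refine presheaf_isIso_of_bijective _ fun P => ?_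
  obtain ⟨P⟩ := P
  rcases subsingleton_or_nontrivial (F.obj (op P)) with hP | hP
  · refine ⟨fun m n _ => Subsingleton.elim (α := F.obj (op P)) m n, fun s => ⟨0, ?_⟩⟩
    rw [map_zero]
    refine coind_ext fun c v => ?_
    rw [map_zero]
    rcases subsingleton_or_nontrivial (F.obj (op (σ.functor.obj c))) with hc | hc
    · exact Subsingleton.elim (α := F.obj (op (σ.functor.obj c))) _ _
    obtain rfl := σ.eq_bot_of_nontrivial F hF c hc
    obtain ⟨b, hb, rfl⟩ := σ.exists_eq_fromBot v
    -- Otherwise `P` would be conjugate to the concentrating subgroup `C`, and `F(P)` would be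
    -- nonzero.
    have hx : ∃ x ∈ P.grp, b * x * b⁻¹ ∉ (σ.functor.obj (botObj _)).grp := by
      by_contra! hx
      have : IsIso (σ.fromBot P b hb) := isIso_homMk _ _ hx
      have h1 := (ConcreteCategory.isIso_iff_bijective (F.map (σ.fromBot P b hb).op)).1
        inferInstance
      exact not_subsingleton (F.obj (op (σ.functor.obj (botObj _))))
        (h1.surjective.subsingleton)
    obtain ⟨x, hxP, hxC⟩ := hx
    obtain ⟨y, hyP, hyC, hyN⟩ := IsPGroup.exists_normalizes (p := p)
      (P := P.grp.map (MulAut.conj b).toMonoidHom) (C := (σ.functor.obj (botObj _)).grp)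
      ((hS.to_le P.le).map _) (by
        rintro _ ⟨k, hk, rfl⟩
        exact ⟨_, hb k hk, by simp [mul_assoc]⟩) ⟨x, hxP, rfl⟩ hxC
    obtain ⟨x, hxP, rfl⟩ := hyP
    obtain ⟨h, hh⟩ := hN _ hyN
    change σ.ι h = b * x * b⁻¹ at hh
    have hqh : IsPGroup p (Subgroup.zpowers (σ.q h)) := by
      obtain ⟨n, hn⟩ := hS.to_le P.le ⟨x, hxP⟩
      have hn : x ^ p ^ n = 1 := congrArg Subtype.val hn
      have hhn : h ^ p ^ n = 1 := σ.inj (by rw [map_pow, hh, conj_pow, hn]; simp)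
      rintro ⟨_, m, rfl⟩
      refine ⟨n, Subtype.ext ?_⟩
      change (σ.q h ^ m) ^ p ^ n = 1
      rw [← zpow_natCast, zpow_comm, zpow_natCast, ← map_pow, hhn, map_one, one_zpow]
    obtain ⟨l, hl⟩ := T.exists_conj_mem hqh
    have hlT : Subgroup.zpowers (l * σ.q h * l⁻¹) ≤ (T : Subgroup L) := by
      rw [Subgroup.zpowers_le]
      exact hl _ (Subgroup.mem_zpowers _)
    -- The element `y` lies in the conjugate of `P` and normalizes `C` without lying in it, so it
    -- gives a nontrivial cyclic `p`-subgroup of `L`. The morphism `C ⟶ P` factors through the image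
    -- of this subgroup, where `F` is zero.
    let c : OrbitCat (T : Subgroup L) := ⟨_, hlT⟩
    have hc1 : Subsingleton (F.obj (op (σ.functor.obj c))) := by
      by_contra hc2
      rw [not_subsingleton_iff_nontrivial] at hc2
      have h3 : l * σ.q h * l⁻¹ ∈ c.grp := Subgroup.mem_zpowers _
      rw [σ.eq_bot_of_nontrivial F hF c hc2] at h3
      have h4 := conj_eq_one_iff.1 (Subgroup.mem_bot.1 h3)
      refine hyC ?_
      change b * x * b⁻¹ ∈ _
      rw [← hh]
      exact σ.ι_mem_functor_obj.2 (h4 ▸ one_mem _)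
    obtain ⟨k, hk⟩ := σ.surj l⁻¹
    have hw : ∀ z ∈ (σ.functor.obj c).grp,
        ((σ.ι k)⁻¹ * b)⁻¹ * z * ((σ.ι k)⁻¹ * b) ∈ P.grp := by
      rintro _ ⟨j, ⟨n, hn⟩, rfl⟩
      have hn : (l * σ.q h * l⁻¹) ^ n = σ.q j := hn
      have h5 : σ.q (h ^ (-n) * (k * j * k⁻¹)) = 1 := by
        rw [map_mul, map_mul, map_mul, map_inv, hk, ← hn, conj_zpow, map_zpow]
        group
      have h6 := mul_mem (zpow_mem hxP n) (hb _ h5)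
      have h7 : x ^ n = b⁻¹ * σ.ι (h ^ n) * b := by
        rw [map_zpow, hh, conj_zpow]
        group
      rw [h7] at h6
      simpa [mul_assoc] using h6
    have h8 : σ.fromBot P b hb = σ.functor.map (botHom c l⁻¹) ≫ homMk _ hw := by
      rw [σ.functor_map_botHom_comp hk, OrbitSpan.fromBot_eq_iff]
      simp [P.grp.one_mem]
    rw [h8, ← map_coindVal]
    have h9 : coindVal σ.functor ((presheafRes σ.functor).obj F) c (homMk _ hw) s = 0 :=
      Subsingleton.elim (α := F.obj (op (σ.functor.obj c))) _ _
    rw [h9, map_zero]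
  · obtain ⟨g, hg⟩ := hF P hP
    have hu : ∀ h, σ.q h = 1 → g⁻¹⁻¹ * σ.ι h * g⁻¹ ∈ P.grp := by
      intro h hh
      rw [hg]
      simpa [mul_assoc] using σ.mem_functor_bot.2 ⟨h, hh, rfl⟩
    let w := σ.fromBot P g⁻¹ hu
    have : IsIso w := isIso_homMk _ _ (by
      intro x hx
      simpa using (hg x).1 hx)
    have hbij := (ConcreteCategory.isIso_iff_bijective (F.map w.op)).1 inferInstance
    refine ⟨fun m n h => hbij.injective ?_, fun s => ?_⟩
    · exact congrArg (coindVal σ.functor _ (botObj _) w) h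
    · obtain ⟨m, hm⟩ := hbij.surjective (coindVal σ.functor _ (botObj _) w s)
      refine ⟨m, coind_ext fun c v => ?_⟩
      rcases subsingleton_or_nontrivial (F.obj (op (σ.functor.obj c))) with hc | hc
      · exact Subsingleton.elim (α := F.obj (op (σ.functor.obj c))) _ _
      obtain rfl := σ.eq_bot_of_nontrivial F hF c hc
      obtain ⟨b, hb, rfl⟩ := σ.exists_eq_fromBot v
      -- Two morphisms from `C` to the conjugate subgroup `P` differ by an element normalizing `C`.
      -- It comes from `H`, so the component at `w` determines all the others.
      obtain ⟨h, hh⟩ := hN (b * g) (by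
        rintro _ ⟨j, hj, rfl⟩
        have := (hg _).1 (hb j hj)
        simpa [mul_assoc] using this)
      have h8 : σ.fromBot P b hb = σ.functor.map (botHom (botObj _) (σ.q h)) ≫ w := by
        rw [σ.functor_map_botHom_comp_fromBot rfl, OrbitSpan.fromBot_eq_iff, hh]
        simp [P.grp.one_mem]
      rw [h8]
      refine Eq.trans ?_ (map_coindVal _ _ s)
      refine Eq.trans ?_ (congrArg (F.map (σ.functor.map (botHom _ (σ.q h))).op) hm)
      change F.map (σ.functor.map _ ≫ w).op m = F.map (σ.functor.map _).op (F.map w.op m)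
      rw [op_comp, F.map_comp]
      rfl

end Concentrated

/-! ### Cutting a presheaf down to part of its support -/

section SupportedSubpresheaf

open Opposite

variable {C : Type u} [SmallCategory C] (F : Cᵒᵖ ⥤ AddCommGrpCat.{u}) (U : C → Prop)
  (hU : ∀ ⦃c d : C⦄, (c ⟶ d) → U d → Nontrivial (F.obj (op c)) → U c)

/-- The subpresheaf of `F` which agrees with `F` on the objects in `U` and vanishes elsewhere. -/
noncomputable def supportedOn : Cᵒᵖ ⥤ AddCommGrpCat.{u} where
  obj c := AddCommGrpCat.of
    ({ carrier := {m | ¬ U c.unop → m = 0}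
       zero_mem' := fun _ => rfl
       add_mem' := fun {a b} ha hb h => by rw [ha h, hb h, add_zero]
       neg_mem' := fun {a} ha h => by rw [ha h, neg_zero] } : AddSubgroup (F.obj c))
  map {c d} f := AddCommGrpCat.ofHom
    { toFun m := ⟨F.map f m.1, fun h => by
        by_cases hc : U c.unop
        · have : Subsingleton (F.obj d) := by
            by_contra hd
            exact h (hU f.unop hc (not_subsingleton_iff_nontrivial.1 hd))
          exact Subsingleton.elim _ _
        · rw [m.2 hc, map_zero]⟩
      map_zero' := Subtype.ext (map_zero _)
      map_add' x y := Subtype.ext (map_add _ _ _) }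
  map_id _ := by
    ext m
    exact ConcreteCategory.congr_hom (F.map_id _) m.1
  map_comp f g := by
    ext m
    exact ConcreteCategory.congr_hom (F.map_comp f g) m.1

noncomputable def supportedOnι : supportedOn F U hU ⟶ F where
  app _ := AddCommGrpCat.ofHom (AddSubgroup.subtype _)
  naturality _ _ _ := rfl

theorem supportedOnι_injective (c : Cᵒᵖ) : Function.Injective ((supportedOnι F U hU).app c) :=
  Subtype.val_injective

instance : Mono (supportedOnι F U hU) :=
  presheaf_mono_of_injective _ (supportedOnι_injective F U hU)

theorem supportedOnι_surjective {c : C} (hc : U c) :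
    Function.Surjective ((supportedOnι F U hU).app (op c)) :=
  fun m => ⟨⟨m, fun h => (h hc).elim⟩, rfl⟩

theorem supportedOn_subsingleton {c : C} (hc : ¬ U c) :
    Subsingleton ((supportedOn F U hU).obj (op c)) :=
  subsingleton_of_forall_eq 0 fun m => Subtype.ext (m.2 hc)

variable {F} in
theorem cokernel_subsingleton {E : Cᵒᵖ ⥤ AddCommGrpCat.{u}} (i : F ⟶ E) [Mono i] {c : Cᵒᵖ}
    (h : Function.Surjective (i.app c)) : Subsingleton ((cokernel i).obj c) := by
  have hS := cokernelSequence_shortExact i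
  refine subsingleton_of_forall_eq 0 fun x => ?_
  obtain ⟨y, rfl⟩ := hS.app_surjective c x
  exact (hS.app_eq_zero_iff c y).2 (h y)

variable {F} in
theorem cokernel_bijective {E : Cᵒᵖ ⥤ AddCommGrpCat.{u}} (i : F ⟶ E) [Mono i] {c : Cᵒᵖ}
    (h : Subsingleton (F.obj c)) : Function.Bijective ((cokernel.π i).app c) := by
  have hS := cokernelSequence_shortExact i
  refine ⟨(injective_iff_map_eq_zero ((cokernel.π i).app c).hom).2 fun y hy => ?_,
    hS.app_surjective c⟩
  obtain ⟨x, rfl⟩ := (hS.app_eq_zero_iff c y).1 hy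
  rw [Subsingleton.elim x 0, map_zero]

end SupportedSubpresheaf

/-! ### Vanishing when an element of order p acts trivially -/

section Vanishing

open OrbitCat Opposite FixedFamily

/-- Counting fixed points of the conjugation action of `P` on `K` shows that `p` divides the order
of the centralizer of `P` in `K`; Cauchy's theorem then applies. -/
theorem IsPGroup.exists_prime_order_centralizing {p : ℕ} [Fact p.Prime] {G : Type*} [Group G]
    [Finite G] {P : Subgroup G} (hP : IsPGroup p P) (K : Subgroup G) [K.Normal]
    (hK : ∃ z ∈ K, z ≠ 1 ∧ z ^ p = 1) :
    ∃ x ∈ K, x ≠ 1 ∧ x ^ p = 1 ∧ ∀ y ∈ P, x⁻¹ * y * x = y := by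
  obtain ⟨z, hzK, hz1, hzp⟩ := hK
  let _ : MulAction P K := MulAction.compHom K ((MulAut.conjNormal (H := K)).comp P.subtype)
  have hsmul : ∀ (y : P) (x : K), ((y • x : K) : G) = y.1 * x.1 * y.1⁻¹ := fun y x =>
    MulAut.conjNormal_apply _ _
  let D : Subgroup G := K ⊓ Subgroup.centralizer P
  have hD : ∀ x : K, x ∈ MulAction.fixedPoints P K ↔ x.1 ∈ D := by
    intro x
    rw [MulAction.mem_fixedPoints, Subgroup.mem_inf, Subgroup.mem_centralizer_iff]
    refine ⟨fun h => ⟨x.2, fun y hy => ?_⟩, fun h y => Subtype.ext ?_⟩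
    · have := congrArg Subtype.val (h ⟨y, hy⟩)
      rw [hsmul] at this
      exact mul_inv_eq_iff_eq_mul.1 this
    · rw [hsmul]
      exact mul_inv_eq_iff_eq_mul.2 (h.2 y y.2)
  let e : MulAction.fixedPoints P K ≃ D :=
    { toFun := fun x => ⟨x.1.1, (hD _).1 x.2⟩
      invFun := fun x => ⟨⟨x.1, x.2.1⟩, (hD _).2 x.2⟩
      left_inv := fun _ => rfl
      right_inv := fun _ => rfl }
  have h1 := hP.card_modEq_card_fixedPoints K
  rw [Nat.card_congr e] at h1
  have h2 : p ∣ Nat.card K := by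
    have : orderOf (⟨z, hzK⟩ : K) = p := orderOf_eq_prime (Subtype.ext hzp)
      fun h => hz1 (congrArg Subtype.val h)
    rw [← this]
    exact orderOf_dvd_natCard _
  have h3 : p ∣ Nat.card D := (Nat.ModEq.dvd_iff h1 dvd_rfl).1 h2
  obtain ⟨x, hx⟩ := exists_prime_orderOf_dvd_card' p h3
  refine ⟨x, x.2.1, ?_, ?_, fun y hy => ?_⟩
  · rintro h
    have : x = 1 := Subtype.ext h
    rw [this, orderOf_one] at hx
    exact (Fact.out : p.Prime).one_lt.ne hx
  · rw [← hx]
    exact congrArg Subtype.val (pow_orderOf_eq_one x)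
  · rw [mul_assoc, Subgroup.mem_centralizer_iff.1 x.2.2 y hy, inv_mul_cancel_left]

/-- Every nonzero value `F(P)` is fixed by an element of order `p` of `N(P)/P`. -/
def HasLocalKernels (p : ℕ) {G : Type u} [Group G] {S : Subgroup G}
    (F : (OrbitCat S)ᵒᵖ ⥤ AddCommGrpCat.{u}) : Prop :=
  ∀ P : OrbitCat S, Nontrivial (F.obj (op P)) →
    ∃ (x : G) (hx : ∀ y ∈ P.grp, x⁻¹ * y * x ∈ P.grp), x ∉ P.grp ∧ x ^ p ∈ P.grp ∧
      ∀ m, F.map (homMk x hx).op m = m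

/-- Higher limits of atomic functors vanish for those modules on which an element of order `p`
acts trivially. -/
def AtomicVanishing (p : ℕ) (k : Type*) [Semiring k] (G : Type u) [Group G] : Prop :=
  ∀ (M : Type u) [AddCommGroup M] [Module k M] (ρ : Representation k G M),
    (∀ m : M, p • m = 0) → (∃ z, z ≠ 1 ∧ z ^ p = 1 ∧ ρ z = 1) →
    ∀ T : Sylow p G, HigherLimsVanish (atomicFunctor ρ (T : Subgroup G))

theorem higherLimsVanish_of_subsingleton {C : Type u} [SmallCategory C]
    (F : Cᵒᵖ ⥤ AddCommGrpCat.{u}) (hF : ∀ c, Subsingleton (F.obj c)) : HigherLimsVanish F := by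
  have hF : IsZero F := by
    rw [IsZero.iff_id_eq_zero]
    ext c x
    exact Subsingleton.elim (α := F.obj c) _ _
  intro n
  rw [isZero_higherLim_iff]
  refine subsingleton_of_forall_eq 0 fun x => ?_
  rw [← Abelian.Ext.comp_mk₀_id x, hF.eq_of_src (𝟙 F) 0, Abelian.Ext.mk₀_zero,
    Abelian.Ext.comp_zero]

variable {p : ℕ} [Fact p.Prime] {G : Type u} [Group G] [Finite G] {T : Sylow p G}

/-- Such a presheaf is coinduced from an atomic functor for `N(P)/P`, a group of smaller order than
`G`, and the local kernel supplies there an element of order `p` acting trivially. Coefficients are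
taken over `ℤ` because the value `F(P)` is only an abelian group. -/
theorem higherLimsVanish_of_concentrated
    (ih : ∀ (L : Type u) [Group L] [Finite L], Nat.card L < Nat.card G → AtomicVanishing p ℤ L)
    (F : (OrbitCat (T : Subgroup G))ᵒᵖ ⥤ AddCommGrpCat.{u})
    (hp : ∀ c (m : F.obj c), p • m = 0) (hD : HasLocalKernels p F)
    (P : OrbitCat (T : Subgroup G)) (hP : P.grp ≠ ⊥)
    (hF : ∀ Q : OrbitCat (T : Subgroup G), Nontrivial (F.obj (op Q)) →
      ∃ g : G, ∀ x, x ∈ Q.grp ↔ g⁻¹ * x * g ∈ P.grp) :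
    HigherLimsVanish F := by
  let N := Subgroup.normalizer (P.grp : Set G)
  let q := QuotientGroup.mk' (P.grp.subgroupOf N)
  obtain ⟨T'⟩ : Nonempty (Sylow p (N ⧸ P.grp.subgroupOf N)) := inferInstance
  obtain ⟨g, σ, hσ, hσq⟩ := OrbitSpan.exists_conj T T' N.subtype q N.subtype_injective
    (QuotientGroup.mk'_surjective _) (by
      rw [QuotientGroup.ker_mk']
      exact (T.2.to_le P.le).comap_of_injective _ N.subtype_injective)
  have hbot : ∀ x, x ∈ (σ.functor.obj (botObj _)).grp ↔ g⁻¹ * x * g ∈ P.grp := by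
    intro x
    rw [σ.mem_functor_bot]
    constructor
    · rintro ⟨h, hh, rfl⟩
      rw [hσq] at hh
      rw [hσ]
      simpa [mul_assoc] using Subgroup.mem_subgroupOf.1 ((QuotientGroup.eq_one_iff h).1 hh)
    · intro hx
      refine ⟨⟨_, Subgroup.le_normalizer hx⟩, ?_, ?_⟩
      · rw [hσq]
        exact (QuotientGroup.eq_one_iff _).2 hx
      · rw [hσ]
        simp [mul_assoc]
  have hF' : ∀ Q : OrbitCat (T : Subgroup G), Nontrivial (F.obj (op Q)) →
      ∃ g : G, ∀ x, x ∈ Q.grp ↔ g⁻¹ * x * g ∈ (σ.functor.obj (botObj _)).grp := by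
    intro Q hQ
    obtain ⟨k, hk⟩ := hF Q hQ
    refine ⟨k * g⁻¹, fun x => ?_⟩
    rw [hk, hbot]
    simp [mul_assoc]
  have hN : ∀ a : G, (∀ x ∈ (σ.functor.obj (botObj _)).grp,
      a⁻¹ * x * a ∈ (σ.functor.obj (botObj _)).grp) → ∃ h, σ.ι h = a := by
    intro a ha
    have h1 : ∀ x ∈ P.grp, (g⁻¹ * a * g)⁻¹ * x * (g⁻¹ * a * g) ∈ P.grp := by
      intro x hx
      have := (hbot _).1 (ha (g * x * g⁻¹) ((hbot _).2 (by simpa [mul_assoc] using hx)))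
      simpa [mul_assoc] using this
    refine ⟨⟨g⁻¹ * a * g, Subgroup.mem_normalizer_iff.2 fun x =>
      ⟨Subgroup.conj_mem_of_conj_le h1 x, fun hx => ?_⟩⟩, ?_⟩
    · simpa [mul_assoc] using h1 _ hx
    · rw [hσ]
      simp [mul_assoc]
  have hiso := σ.isIso_unit F hF' hN T.2
  refine HigherLimsVanish.of_iso (HigherLimsVanish.coind ?_ (σ.homsAreCoproducts T.2))
    (asIso (coindLift σ.functor (𝟙 ((presheafRes σ.functor).obj F)))).symm
  rcases subsingleton_or_nontrivial (F.obj (op (σ.functor.obj (botObj _)))) with h0 | h0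
  · refine higherLimsVanish_of_subsingleton _ fun c => ?_
    by_contra h
    rw [not_subsingleton_iff_nontrivial] at h
    have h' : Nontrivial (F.obj (op (σ.functor.obj c.unop))) := h
    rw [σ.eq_bot_of_nontrivial F hF' c.unop h'] at h'
    exact not_subsingleton _ h0
  obtain ⟨e⟩ := nonempty_iso_atomicFunctor (botRep ((presheafRes σ.functor).obj F))
    ((presheafRes σ.functor).obj F) (fun c hc => by
      by_contra h
      rw [not_subsingleton_iff_nontrivial] at h
      refine hc ?_
      rw [σ.eq_bot_of_nontrivial F hF' c h]
      rfl) (AddEquiv.refl _) fun _ _ => rfl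
  refine HigherLimsVanish.of_iso (ih _ ?_ _ (botRep ((presheafRes σ.functor).obj F))
    (fun m => hp _ m) ?_ T') e.symm
  · have h1 : Nat.card P.grp ≠ 1 := fun h => hP (Subgroup.card_eq_one.1 h)
    have h2 : Nat.card (N ⧸ P.grp.subgroupOf N) * Nat.card (P.grp.subgroupOf N) = Nat.card N :=
      (Subgroup.card_eq_card_quotient_mul_card_subgroup _).symm
    rw [Nat.card_congr (Subgroup.subgroupOfEquivOfLe Subgroup.le_normalizer).toEquiv] at h2
    have h3 : 0 < Nat.card P.grp := Nat.card_pos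
    have h4 : 0 < Nat.card (N ⧸ P.grp.subgroupOf N) := Nat.card_pos
    have h5 : Nat.card N ≤ Nat.card G := Subgroup.card_le_card_group N
    nlinarith [show 2 ≤ Nat.card P.grp by omega]
  · obtain ⟨x, hx, hxC, hxp, hxF⟩ := hD _ h0
    obtain ⟨h, rfl⟩ := hN x hx
    rw [σ.ι_mem_functor_obj] at hxC
    rw [← map_pow, σ.ι_mem_functor_obj] at hxp
    refine ⟨σ.q h, hxC, ?_, LinearMap.ext fun m => ?_⟩
    · rw [← map_pow]
      exact hxp
    · refine Eq.trans ?_ (hxF m)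
      change F.map (σ.functor.map (botHom (botObj _) (σ.q h))).op m = _
      rw [σ.functor_map_botHom rfl]
      rfl

/-- Induction on the number of subgroups with nonzero value, splitting off at each stage the
conjugacy class of a support subgroup of least order. -/
theorem higherLimsVanish_of_hasLocalKernels
    (ih : ∀ (L : Type u) [Group L] [Finite L], Nat.card L < Nat.card G → AtomicVanishing p ℤ L)
    (n : ℕ) : ∀ (F : (OrbitCat (T : Subgroup G))ᵒᵖ ⥤ AddCommGrpCat.{u}),
    {P : OrbitCat (T : Subgroup G) | Nontrivial (F.obj (op P))}.ncard = n →
    (∀ c (m : F.obj c), p • m = 0) → HasLocalKernels p F →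
    (∀ P : OrbitCat (T : Subgroup G), Nontrivial (F.obj (op P)) → P.grp ≠ ⊥) →
    HigherLimsVanish F := by
  have : Finite (OrbitCat (T : Subgroup G)) :=
    Finite.of_injective OrbitCat.grp fun P Q h => OrbitCat.ext h
  induction n using Nat.strong_induction_on with
  | _ n ihn =>
  intro F hn hp hD hbot
  by_cases h0 : ∀ c, Subsingleton (F.obj c)
  · exact higherLimsVanish_of_subsingleton F h0
  push Not at h0
  obtain ⟨⟨P'⟩, hP'⟩ := h0
  obtain ⟨P, hP, hmin⟩ := Set.exists_min_image
    {P : OrbitCat (T : Subgroup G) | Nontrivial (F.obj (op P))} (fun P => Nat.card P.grp)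
    (Set.toFinite _) ⟨P', hP'⟩
  let U : OrbitCat (T : Subgroup G) → Prop := fun Q => ∃ g : G, ∀ x, x ∈ Q.grp ↔ g⁻¹ * x * g ∈ P.grp
  have hUP : U P := ⟨1, fun x => by simp⟩
  -- Minimality makes the class closed under restriction: a subgroup of the support which is
  -- subconjugate to `P` has at least the order of `P`, so it is conjugate to `P`.
  have hU : ∀ ⦃c d : OrbitCat (T : Subgroup G)⦄, (c ⟶ d) → U d → Nontrivial (F.obj (op c)) →
      U c := by
    rintro c d φ ⟨g, hg⟩ hc
    obtain ⟨a, ha, -⟩ := exists_eq_homMk φ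
    have hle : c.grp.map (MulAut.conj (a * g)⁻¹).toMonoidHom ≤ P.grp := by
      rintro _ ⟨x, hx, rfl⟩
      have := (hg _).1 (ha x hx)
      simpa [mul_assoc] using this
    have hcard : Nat.card (c.grp.map (MulAut.conj (a * g)⁻¹).toMonoidHom) = Nat.card c.grp :=
      Nat.card_congr (c.grp.equivMapOfInjective _ (MulAut.conj (a * g)⁻¹).injective).toEquiv.symm
    have heq := Subgroup.eq_of_le_of_card_ge hle (hcard ▸ hmin c hc)
    refine ⟨a * g, fun x => ?_⟩
    rw [← heq]
    constructor
    · exact fun hx => ⟨x, hx, by simp [mul_assoc]⟩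
    · rintro ⟨y, hy, hyx⟩
      have : y = x := (MulAut.conj (a * g)⁻¹).injective (hyx.trans (by simp [mul_assoc]))
      rwa [← this]
  let i := supportedOnι F U hU
  have hS := cokernelSequence_shortExact i
  have hsub : ∀ {Q}, ¬ U Q → Subsingleton ((supportedOn F U hU).obj (op Q)) :=
    supportedOn_subsingleton F U hU
  have hcok : ∀ {Q}, Nontrivial ((cokernel i).obj (op Q)) →
      ¬ U Q ∧ Nontrivial (F.obj (op Q)) := by
    intro Q hQ
    have h1 : ¬ U Q := fun h =>
      not_subsingleton _ (cokernel_subsingleton i (supportedOnι_surjective F U hU h))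
    exact ⟨h1, (cokernel_bijective i (hsub h1)).surjective.nontrivial⟩
  refine HigherLimsVanish.middle hS ?_ ?_
  · refine higherLimsVanish_of_concentrated ih (supportedOn F U hU)
      (fun c m => ?_) (fun Q hQ => ?_) P (hbot P hP) (fun Q hQ => ?_)
    · apply supportedOnι_injective F U hU c
      rw [map_nsmul, map_zero]
      exact hp _ _
    · obtain ⟨x, hx, h1, h2, h3⟩ := hD Q (supportedOnι_injective F U hU (op Q)).nontrivial
      exact ⟨x, hx, h1, h2, fun m => supportedOnι_injective F U hU _ (h3 _)⟩
    · by_contra h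
      exact not_subsingleton _ (hsub h)
  · refine ihn _ ?_ (cokernel i) rfl (fun c m => ?_) (fun Q hQ => ?_)
      fun Q hQ => hbot Q (hcok hQ).2
    · rw [← hn]
      refine Set.ncard_lt_ncard ⟨fun Q hQ => (hcok hQ).2, fun h => ?_⟩ (Set.toFinite _)
      exact (hcok (h hP)).1 hUP
    · obtain ⟨y, rfl⟩ := hS.app_surjective c m
      rw [← map_nsmul, show p • y = 0 from hp c y, map_zero]
    · obtain ⟨x, hx, h1, h2, h3⟩ := hD Q (hcok hQ).2
      refine ⟨x, hx, h1, h2, fun m => ?_⟩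
      obtain ⟨y, rfl⟩ := hS.app_surjective _ m
      refine (ConcreteCategory.congr_hom
        ((cokernel.π i).naturality (homMk x hx).op) y).symm.trans ?_
      exact congrArg ((cokernel.π i).app (op Q)) (h3 y)

/-- With `K` the kernel of the action, `E_K` is acyclic by transfer. On the support of `E_K / F_M`
one has `P ∩ K = 1` and `P ≠ 1`, and an element of order `p` in `K` centralizing `P` serves as local
kernel: it lies outside `P` and acts trivially on `M`. -/
theorem AtomicVanishing.of_lt {k : Type*} [Semiring k]
    (ih : ∀ (L : Type u) [Group L] [Finite L], Nat.card L < Nat.card G → AtomicVanishing p ℤ L) :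
    AtomicVanishing p k G := by
  intro M _ _ ρ hM hz T
  obtain ⟨z, hz1, hzp, hρz⟩ := hz
  let K := ρ.ker
  have hK : ∀ {x}, x ∈ K ↔ ρ x = 1 := MonoidHom.mem_ker
  let i := incl (ρ := ρ) (S := (T : Subgroup G)) (atomic_le_fixedOff K)
  have hS := cokernelSequence_shortExact i
  refine HigherLimsVanish.left hS ?_ ?_
  · refine higherLimsVanish_fixedOff hM (fun x hx => hK.1 hx) ?_
    have hzT : IsPGroup p (Subgroup.zpowers z) := by
      rintro ⟨_, m, rfl⟩
      refine ⟨1, Subtype.ext ?_⟩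
      change (z ^ m) ^ p ^ 1 = 1
      rw [pow_one, ← zpow_natCast, zpow_comm, zpow_natCast, hzp, one_zpow]
    obtain ⟨l, hl⟩ := T.exists_conj_mem hzT
    refine ⟨_, hl z (Subgroup.mem_zpowers z), ?_, fun h => hz1 (conj_eq_one_iff.1 h)⟩
    exact (inferInstance : K.Normal).conj_mem z (hK.2 hρz) l
  · have hne : ∀ P : OrbitCat (T : Subgroup G), Nontrivial ((cokernel i).obj (op P)) →
        P.grp ≠ ⊥ := by
      intro P hP hbot
      refine @not_subsingleton _ hP (cokernel_subsingleton i fun m => ?_)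
      refine ⟨(atomic ρ _).elem ((fixedOff ρ _ K).val P m)
        (mem_atomicObj.2 fun h => (h hbot).elim), (fixedOff ρ _ K).val_injective P rfl⟩
    refine higherLimsVanish_of_hasLocalKernels ih _ (cokernel i) rfl (fun c m => ?_)
      (fun P hP => ?_) hne
    · obtain ⟨y, rfl⟩ := hS.app_surjective c m
      rw [← map_nsmul]
      refine (congrArg _ ?_).trans (map_zero _)
      refine (fixedOff ρ _ K).val_injective c.unop ?_
      rw [map_nsmul, hM, map_zero]
    · have hE : Nontrivial ((fixedOff ρ (T : Subgroup G) K).presheaf.obj (op P)) :=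
        Function.Surjective.nontrivial (f := (cokernel.π i).app (op P)) (hS.app_surjective (op P))
      obtain ⟨m, hm⟩ := exists_ne (0 : (fixedOff ρ (T : Subgroup G) K).presheaf.obj (op P))
      obtain ⟨x, hxK, hx1, hxp, hx⟩ := (T.2.to_le P.le).exists_prime_order_centralizing K
        ⟨z, hK.2 hρz, hz1, hzp⟩
      refine ⟨x, fun y hy => by rwa [hx y hy], fun hxP => hm ?_, hxp ▸ one_mem _, fun n => ?_⟩
      · refine (fixedOff ρ _ K).val_injective P ?_
        rw [map_zero]
        exact ((fixedOff ρ _ K).val_mem m).2 x hxP hxK hx1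
      · obtain ⟨y, rfl⟩ := hS.app_surjective _ n
        refine (ConcreteCategory.congr_hom
          ((cokernel.π i).naturality (homMk x _).op) y).symm.trans ?_
        refine congrArg ((cokernel.π i).app (op P)) ?_
        refine (fixedOff ρ _ K).val_injective P ?_
        refine ((fixedOff ρ _ K).val_map_homMk x _ y).trans ?_
        rw [hK.1 hxK]
        rfl

theorem atomicVanishing_int (n : ℕ) : ∀ (L : Type u) [Group L] [Finite L], Nat.card L = n →
    AtomicVanishing p ℤ L := by
  induction n using Nat.strong_induction_on with
  | _ n ih =>
  intro L _ _ hL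
  exact AtomicVanishing.of_lt fun L' _ _ h => ih _ (hL ▸ h) L' rfl

theorem atomicVanishing (k : Type*) [Semiring k] : AtomicVanishing p k G :=
  AtomicVanishing.of_lt fun L _ _ _ => atomicVanishing_int _ L rfl

end Vanishing

/-! ### Maps out of restricted fixed-point presheaves -/

section FixedFamilyRestriction

open OrbitCat Opposite FixedFamily

variable {G L H : Type u} [Group G] [Group L] [Group H] {S : Subgroup G} {S' : Subgroup L}
  {k k' : Type*} [Semiring k] [Semiring k'] {M M' : Type u} [AddCommGroup M] [AddCommGroup M']
  [Module k M] [Module k' M'] {ρ : Representation k G M} {ρ' : Representation k' L M'}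

theorem FixedFamily.val_map_functor_homMk (σ : OrbitSpan S S' H) (A : FixedFamily ρ S)
    {P Q : OrbitCat S'} (h : H) (hh : ∀ x ∈ P.grp, (σ.q h)⁻¹ * x * σ.q h ∈ Q.grp)
    (m : A.presheaf.obj (op (σ.functor.obj Q))) :
    A.val _ (A.presheaf.map (σ.functor.map (homMk (σ.q h) hh)).op m) = ρ (σ.ι h) (A.val _ m) := by
  rw [σ.functor_map_homMk h hh]
  exact A.val_map_homMk _ _ _

/-- The map from the restriction of a presheaf of fixed points along a span, defined by an
equivariant map of modules. -/
noncomputable def FixedFamily.resHom (σ : OrbitSpan S S' H) (A : FixedFamily ρ S)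
    (B : FixedFamily ρ' S') (e : M →+ M') (he : ∀ h m, e (ρ (σ.ι h) m) = ρ' (σ.q h) (e m))
    (hmem : ∀ c, ∀ m ∈ A.sub (σ.functor.obj c), e m ∈ B.sub c) :
    (presheafRes σ.functor).obj A.presheaf ⟶ B.presheaf where
  app c := AddCommGrpCat.ofHom
    { toFun := fun m => B.elem (e (A.val _ m)) (hmem c.unop _ (A.val_mem m))
      map_zero' := B.val_injective c.unop ((congrArg e (map_zero _)).trans (map_zero e))
      map_add' := fun m m' => B.val_injective c.unop
        ((congrArg e (map_add (A.val _) m m')).trans (map_add e _ _)) }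
  naturality c d φ := by
    ext m
    obtain ⟨l, hl, hφ⟩ := exists_eq_homMk φ.unop
    obtain ⟨h, rfl⟩ := σ.surj l
    have hφ' : φ = (homMk (σ.q h) hl).op := by rw [← hφ]; rfl
    subst hφ'
    refine B.val_injective d.unop ?_
    refine Eq.trans ?_ (B.val_map_homMk _ hl _).symm
    refine Eq.trans ?_ (he h _)
    exact congrArg e (A.val_map_functor_homMk σ h hl m)

theorem FixedFamily.atomic_subsingleton {c : OrbitCat S} (hc : c.grp ≠ ⊥) :
    Subsingleton ((atomic ρ S).presheaf.obj (op c)) :=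
  subsingleton_of_forall_eq 0 fun m => (atomic ρ S).val_injective c
    ((mem_atomicObj.1 ((atomic ρ S).val_mem m) hc).trans (map_zero _).symm)

end FixedFamilyRestriction

/-! ### Wreath products: acyclicity of the presheaf attached to the base group -/

section WreathProducts

open OrbitCat Opposite FixedFamily RegularWreathProduct

/-- The inclusion of the base group in a wreath product. -/
def RegularWreathProduct.base {G Q : Type*} [Group G] [Group Q] : (Q → G) →* G ≀ᵣ Q where
  toFun f := ⟨f, 1⟩
  map_one' := rfl
  map_mul' f f' := by
    ext x
    · change f x * f' x = f x * f' (1⁻¹ * x)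
      simp
    · simp

theorem RegularWreathProduct.base_mul_inl {G Q : Type*} [Group G] [Group Q] (v : G ≀ᵣ Q) :
    base v.left * inl v.right = v := by
  ext x
  · change v.left x * 1 = _
    simp
  · change 1 * v.right = v.right
    simp

variable {G Q : Type u} [Group G] [Group Q] {k : Type*} [Semiring k] {M : Type u}
  [AddCommGroup M] [Module k M] (ρ : Representation k G M)

/-- The action of the base group through one coordinate. -/
def baseRep (Q : Type u) [Group Q] : Representation k (Q → G) M :=
  MonoidHom.comp ρ (Pi.evalMonoidHom (fun _ : Q => G) 1)

theorem wreathRep_apply (v : G ≀ᵣ Q) (w : Q → M) (x : Q) :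
    wreathRep Q ρ v w x = ρ (v.left x) (w (v.right⁻¹ * x)) := rfl

theorem wreathRep_base (f : Q → G) (w : Q → M) :
    wreathRep Q ρ (base f) w 1 = baseRep ρ Q f (w 1) := by
  rw [wreathRep_apply]
  change ρ (f 1) (w (1⁻¹ * 1)) = ρ (f 1) (w 1)
  simp

theorem wreathRep_inl (c x : Q) (w : Q → M) :
    wreathRep Q ρ (inl c) w x = w (c⁻¹ * x) := by
  rw [wreathRep_apply]
  simp

theorem eq_zero_of_wreathRep_one (g : G ≀ᵣ Q) (w : Q → M)
    (h : ∀ b, wreathRep Q ρ (g⁻¹ * b) w 1 = 0) : w = 0 := by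
  funext x
  have := h (g * inl x⁻¹)
  rw [inv_mul_cancel_left, wreathRep_inl] at this
  simpa using this

/-- The first coordinate, in coordinates conjugated by a group element. -/
def conjCoord (g : G ≀ᵣ Q) : (Q → M) →+ M :=
  (Pi.evalAddMonoidHom (fun _ => M) (1 : Q)).comp (wreathRep Q ρ g⁻¹).toAddMonoidHom

theorem conjCoord_wreathRep (g b : G ≀ᵣ Q) (w : Q → M) :
    conjCoord ρ g (wreathRep Q ρ b w) = wreathRep Q ρ (g⁻¹ * b) w 1 := by
  rw [map_mul]
  rfl

theorem conjCoord_wreathRep_conj (g b : G ≀ᵣ Q) (w : Q → M) :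
    conjCoord ρ g (wreathRep Q ρ (g * b * g⁻¹) w) = wreathRep Q ρ b (wreathRep Q ρ g⁻¹ w) 1 := by
  rw [conjCoord_wreathRep, mul_assoc, inv_mul_cancel_left, map_mul]
  rfl

variable {p : ℕ} [Fact p.Prime] [Finite G] [Finite Q] {T : Sylow p (G ≀ᵣ Q)}

/-- The module `M^Q` is coinduced from the base group acting on `M` through one coordinate.
Correspondingly this presheaf is coinduced from an atomic functor of the base group, on which
elements of the other coordinates act trivially. -/
theorem higherLimsVanish_fixedOff_base (hM : ∀ m : M, p • m = 0) (hG : p ∣ Nat.card G)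
    (hQ : 1 < Nat.card Q) :
    HigherLimsVanish (fixedOff (wreathRep Q ρ) (T : Subgroup (G ≀ᵣ Q))
      (rightHom : G ≀ᵣ Q →* Q).ker).presheaf := by
  obtain ⟨T'⟩ : Nonempty (Sylow p (Q → G)) := inferInstance
  obtain ⟨g, σ, hσ, hσq⟩ := OrbitSpan.exists_conj T T' (base : (Q → G) →* G ≀ᵣ Q) (MonoidHom.id _)
    (fun f f' h => congrArg RegularWreathProduct.left h) Function.surjective_id
    (by
      rintro ⟨x, hx⟩
      exact ⟨0, Subtype.ext ((pow_one x).trans hx)⟩)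
  have hq : ∀ f, σ.q f = f := fun f => by rw [hσq]; rfl
  let E := fixedOff (wreathRep Q ρ) (T : Subgroup (G ≀ᵣ Q)) (rightHom : G ≀ᵣ Q →* Q).ker
  let A := atomic (baseRep ρ Q) (T' : Subgroup (Q → G))
  have hbase : ∀ x : G ≀ᵣ Q, x ∈ (rightHom : G ≀ᵣ Q →* Q).ker ↔ ∃ f, σ.ι f = x := by
    intro x
    constructor
    · intro hx
      refine ⟨(g⁻¹ * x * g).left, ?_⟩
      have h1 : rightHom (g⁻¹ * x * g) = 1 := by
        rw [map_mul, map_mul, MonoidHom.mem_ker.1 hx, map_inv]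
        simp
      have h2 : base (g⁻¹ * x * g).left = g⁻¹ * x * g := by
        conv_rhs => rw [← base_mul_inl (g⁻¹ * x * g)]
        rw [show (g⁻¹ * x * g).right = 1 from h1, map_one, mul_one]
      rw [hσ, h2]
      simp [mul_assoc]
    · rintro ⟨f, rfl⟩
      rw [hσ, MonoidHom.mem_ker, map_mul, map_mul, map_inv]
      change rightHom g * 1 * _ = 1
      simp
  have he : ∀ f w, conjCoord ρ g (wreathRep Q ρ (σ.ι f) w) =
      baseRep ρ Q (σ.q f) (conjCoord ρ g w) := fun f w => by
    rw [hσ, conjCoord_wreathRep_conj, wreathRep_base, hq]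
    rfl
  have hmem : ∀ c, ∀ w ∈ E.sub (σ.functor.obj c), conjCoord ρ g w ∈ A.sub c :=
    fun c w hw => mem_atomicObj.2 fun hc => by
      obtain ⟨⟨f, hf⟩, hf1⟩ := Subgroup.ne_bot_iff_exists_ne_one.1 hc
      rw [hw.2 (σ.ι f) (σ.ι_mem_functor_obj.2 (by rwa [hq])) ((hbase _).2 ⟨f, rfl⟩) ?_, map_zero]
      exact fun h => hf1 (Subtype.ext (σ.inj (h.trans (map_one _).symm)))
  let α := E.resHom σ A (conjCoord ρ g) he hmem
  have hbot : ∀ (P : OrbitCat (T : Subgroup (G ≀ᵣ Q))) (b : G ≀ᵣ Q) h, σ.q h = 1 →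
      b⁻¹ * σ.ι h * b ∈ P.grp := fun P b h hh => by
    rw [← hq h, hh, map_one]
    simp [P.grp.one_mem]
  have hval : ∀ P b (w : E.presheaf.obj (op P)), A.val _ (coindVal σ.functor A.presheaf (botObj _)
      (σ.fromBot P b (hbot P b)) ((coindLift σ.functor α).app (op P) w)) =
      wreathRep Q ρ (g⁻¹ * b) (E.val _ w) 1 := by
    intro P b w
    rw [coindVal_lift, ← conjCoord_wreathRep]
    exact congrArg (conjCoord ρ g) (E.val_map_homMk b _ w)
  have : IsIso (coindLift σ.functor α) := by
    refine presheaf_isIso_of_bijective _ fun P => ?_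
    obtain ⟨P⟩ := P
    constructor
    · rw [injective_iff_map_eq_zero]
      intro w hw
      refine E.val_injective P ?_
      rw [map_zero]
      refine eq_zero_of_wreathRep_one ρ g _ fun b => ?_
      rw [← hval, hw, map_zero, map_zero]
    intro s
    -- A section over `P` becomes a function on the whole wreath product, equivariant on the left
    -- for the base group and invariant on the right under `P`.
    let t : G ≀ᵣ Q → M := fun b => A.val _ (coindVal σ.functor A.presheaf (botObj _)
      (σ.fromBot P b (hbot P b)) s)
    have ht1 : ∀ f b, t (σ.ι f * b) = baseRep ρ Q f (t b) := by
      intro f b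
      have h1 := map_coindVal (botHom (botObj _) f) (σ.fromBot P b (hbot P b)) s
      rw [σ.functor_map_botHom_comp_fromBot (hq f)] at h1
      exact (congrArg (A.val _) h1.symm).trans (A.val_map_homMk _ _ _)
    have ht2 : ∀ b, ∀ y ∈ P.grp, t (b * y) = t b := by
      intro b y hy
      have h1 : σ.fromBot P (b * y) (hbot P _) = σ.fromBot P b (hbot P _) := by
        rw [OrbitSpan.fromBot_eq_iff]
        simpa using inv_mem hy
      exact congrArg (fun v => A.val _ (coindVal σ.functor A.presheaf (botObj _) v s)) h1
    -- Conjugated by `b`, the element `x` gives a nontrivial `p`-element of the base group; the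
    -- morphism defining `t b` factors through the image of the cyclic group it generates, up to
    -- conjugacy, where the atomic functor is zero.
    have ht3 : ∀ x ∈ P.grp, x ∈ (rightHom : G ≀ᵣ Q →* Q).ker → x ≠ 1 → ∀ b, t b = 0 := by
      intro x hxP hxK hx1 b
      obtain ⟨f, hf⟩ := (hbase _).1 ((inferInstance :
        (rightHom : G ≀ᵣ Q →* Q).ker.Normal).conj_mem x hxK b)
      have hfp : IsPGroup p (Subgroup.zpowers f) := by
        obtain ⟨n, hn⟩ := T.2 ⟨x, P.le hxP⟩
        have hn : x ^ p ^ n = 1 := congrArg Subtype.val hn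
        have hfn : f ^ p ^ n = 1 := σ.inj (by rw [map_pow, hf, conj_pow, hn]; simp)
        rintro ⟨_, m, rfl⟩
        refine ⟨n, Subtype.ext ?_⟩
        change (f ^ m) ^ p ^ n = 1
        rw [← zpow_natCast, zpow_comm, zpow_natCast, hfn, one_zpow]
      obtain ⟨l, hl⟩ := T'.exists_conj_mem hfp
      have hlT : Subgroup.zpowers (l * f * l⁻¹) ≤ (T' : Subgroup (Q → G)) := by
        rw [Subgroup.zpowers_le]
        exact hl _ (Subgroup.mem_zpowers _)
      let c : OrbitCat (T' : Subgroup (Q → G)) := ⟨_, hlT⟩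
      have hc : c.grp ≠ ⊥ := by
        intro h
        rw [Subgroup.zpowers_eq_bot, conj_eq_one_iff] at h
        rw [h, map_one, eq_comm, conj_eq_one_iff] at hf
        exact hx1 hf
      have hw : ∀ z ∈ (σ.functor.obj c).grp,
          (σ.ι l * b)⁻¹ * z * (σ.ι l * b) ∈ P.grp := by
        rintro _ ⟨j, ⟨n, hn⟩, rfl⟩
        have hn : (l * f * l⁻¹) ^ n = σ.q j := hn
        rw [← hq j, ← hn, conj_zpow, map_mul, map_mul, map_zpow, hf, conj_zpow, map_inv]
        simpa [mul_assoc] using zpow_mem hxP n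
      have h8 : σ.fromBot P b (hbot P b) = σ.functor.map (botHom c l⁻¹) ≫ homMk _ hw := by
        rw [σ.functor_map_botHom_comp (hq _), OrbitSpan.fromBot_eq_iff]
        simp [P.grp.one_mem]
      have := atomic_subsingleton (ρ := baseRep ρ Q) hc
      change A.val _ (coindVal σ.functor A.presheaf _ _ s) = 0
      rw [h8, ← map_coindVal]
      have h9 : coindVal σ.functor A.presheaf c (homMk _ hw) s = 0 := this.elim _ _
      rw [h9, map_zero, map_zero]
    -- The elements `inl x⁻¹` represent the cosets of the base group, so by equivariance these
    -- values of `t` determine it.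
    let w : Q → M := fun x => t (g * inl x⁻¹)
    have hw : ∀ b, wreathRep Q ρ (g⁻¹ * b) w 1 = t b := by
      intro b
      rw [← base_mul_inl (g⁻¹ * b), map_mul, Module.End.mul_apply, wreathRep_base, wreathRep_inl]
      change baseRep ρ Q _ (t _) = _
      rw [← ht1, hσ]
      congr 1
      simp only [mul_one, inv_inv, mul_assoc, inv_mul_cancel_left]
      rw [base_mul_inl, mul_inv_cancel_left]
    have hwmem : w ∈ E.sub P := by
      refine ⟨fun x hx => sub_eq_zero.1 (eq_zero_of_wreathRep_one ρ g _ fun b => ?_),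
        fun x hx hK h1 => funext fun c => ht3 x hx hK h1 _⟩
      rw [map_sub, ← Module.End.mul_apply, ← map_mul, mul_assoc, Pi.sub_apply, hw, hw, ht2 b x hx,
        sub_self]
    refine ⟨E.elem w hwmem, coind_ext fun c v => ?_⟩
    by_cases hc : c.grp = ⊥
    · obtain rfl := eq_botObj hc
      obtain ⟨b, hb, rfl⟩ := σ.exists_eq_fromBot v
      refine A.val_injective _ ?_
      rw [hval]
      exact hw b
    · exact (atomic_subsingleton (ρ := baseRep ρ Q) hc).elim _ _
  refine HigherLimsVanish.of_iso (HigherLimsVanish.coind ?_ (σ.homsAreCoproducts T.2))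
    (asIso (coindLift σ.functor α)).symm
  refine atomicVanishing k M (baseRep ρ Q) hM ?_ T'
  classical
  obtain ⟨z, hz⟩ := exists_prime_orderOf_dvd_card' p hG
  have : Nontrivial Q := Finite.one_lt_card_iff_nontrivial.1 hQ
  obtain ⟨c, hc⟩ := exists_ne (1 : Q)
  -- An element of order `p` placed in a coordinate other than the one through which `M` is acted
  -- on.
  refine ⟨(Pi.mulSingle c z : Q → G), ?_, ?_, ?_⟩
  · intro h
    have h1 : z = 1 := by simpa using congrFun h c
    rw [h1, orderOf_one] at hz
    exact (Fact.out : p.Prime).one_lt.ne hz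
  · rw [← Pi.mulSingle_pow, ← hz, pow_orderOf_eq_one, Pi.mulSingle_one]
  · change ρ ((Pi.mulSingle c z : Q → G) 1) = 1
    rw [Pi.mulSingle_eq_of_ne hc.symm, map_one]

end WreathProducts

/-! ### The degree shift for wreath products with a group of order p -/

section WreathReduction

open OrbitCat Opposite FixedFamily RegularWreathProduct

/-- The inclusion of the product of the diagonal of the base group and the acting group. -/
def RegularWreathProduct.diag {G Q : Type*} [Group G] [Group Q] : G × Q →* G ≀ᵣ Q where
  toFun x := ⟨fun _ => x.1, x.2⟩
  map_one' := rfl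
  map_mul' _ _ := rfl

theorem RegularWreathProduct.diag_mk_one {G Q : Type*} [Group G] [Group Q] (c : Q) :
    diag (1, c) = (inl c : G ≀ᵣ Q) := rfl

/-- Complements of the base group in a wreath product are conjugate. -/
theorem RegularWreathProduct.exists_conj_of_isComplement {G Q : Type*} [Group G] [Group Q]
    {P : Subgroup (G ≀ᵣ Q)} (h1 : ∀ x ∈ P, x.right = 1 → x = 1) (h2 : ∀ c, ∃ x ∈ P, x.right = c) :
    ∃ g : G ≀ᵣ Q, ∀ x, x ∈ P ↔ ∃ c, g⁻¹ * x * g = inl c := by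
  choose s hsP hs using h2
  have hmul : ∀ c d, s (c * d) = s c * s d := by
    intro c d
    refine (inv_mul_eq_one.1 (h1 _ (mul_mem (inv_mem (hsP (c * d)))
      (mul_mem (hsP c) (hsP d))) ?_))
    simp [hs]
  -- The section `s` is a homomorphism, so its base component is a cocycle with values in a
  -- coinduced group, which is a coboundary as in Shapiro's lemma. The conjugating element takes the
  -- coordinate at `z` of `s z`.
  have key : ∀ c, s c * base (fun z => (s z).left z) = base (fun z => (s z).left z) * inl c := by
    intro c
    ext z
    · have h3 := congrArg (fun x => x.left z) (hmul c (c⁻¹ * z))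
      rw [mul_inv_cancel_left] at h3
      simp only [mul_left, Pi.mul_apply, hs] at h3
      change (s c).left z * (s ((s c).right⁻¹ * z)).left ((s c).right⁻¹ * z) = (s z).left z * 1
      rw [hs, mul_one, h3]
    · change (s c).right * 1 = 1 * c
      rw [hs, mul_one, one_mul]
  have key' : ∀ c, (base fun z => (s z).left z)⁻¹ * s c * (base fun z => (s z).left z) = inl c :=
    fun c => by rw [mul_assoc, key, inv_mul_cancel_left]
  refine ⟨base (fun z => (s z).left z), fun x => ⟨fun hx => ⟨x.right, ?_⟩, ?_⟩⟩
  · rw [← key']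
    congr 2
    refine (inv_mul_eq_one.1 (h1 _ (mul_mem (inv_mem (hsP _)) hx) ?_)).symm
    simp [hs]
  · rintro ⟨c, hc⟩
    rw [← key'] at hc
    have : x = s c := by simpa [mul_assoc] using hc
    rw [this]
    exact hsP c

/-- Comparing base components at `z` in `inl z * v = v * inl d` shows that `v.left z = v.left 1`. -/
theorem RegularWreathProduct.exists_diag_of_normalizes {G Q : Type*} [Group G] [Group Q]
    {v : G ≀ᵣ Q} (hv : ∀ c : Q, ∃ d : Q, v⁻¹ * inl c * v = inl d) : ∃ x, diag x = v := by
  refine ⟨(v.left 1, v.right), ?_⟩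
  ext z
  · change v.left 1 = v.left z
    obtain ⟨d, hd⟩ := hv z
    have h1 := congrArg (fun x => x.left z)
      (inv_mul_eq_iff_eq_mul.1 ((mul_assoc _ _ _).symm.trans hd))
    change 1 * v.left (z⁻¹ * z) = v.left z * 1 at h1
    simpa using h1
  · rfl

variable {G Q : Type u} [Group G] [Group Q] {k : Type*} [Semiring k] {M : Type u} [AddCommGroup M]
  [Module k M] (ρ : Representation k G M)

theorem wreathRep_diag (x : G × Q) (w : Q → M) (hw : ∀ c, w c = w 1) :
    wreathRep Q ρ (diag x) w 1 = ρ x.1 (w 1) := by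
  rw [wreathRep_apply, hw]
  rfl

variable {p : ℕ} [Fact p.Prime] [Finite G] [Finite Q]

/-- Passing to the wreath product with a group of order `p` shifts the groups `Λ` by one. -/
theorem nonempty_Lambda_wreath (hM : ∀ m : M, p • m = 0) (hG : p ∣ Nat.card G)
    (hQ : Nat.card Q = p) (T : Sylow p (G ≀ᵣ Q)) (T' : Sylow p G) (n : ℕ) :
    Nonempty (Lambda (wreathRep Q ρ) T (n + 1) ≃+ Lambda ρ T' n) := by
  have hp : p.Prime := Fact.out
  let N := (rightHom : G ≀ᵣ Q →* Q).ker
  have hN : ∀ {x}, x ∈ N ↔ x.right = 1 := MonoidHom.mem_ker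
  let E := fixedOff (wreathRep Q ρ) (T : Subgroup (G ≀ᵣ Q)) N
  let i := incl (ρ := wreathRep Q ρ) (S := (T : Subgroup (G ≀ᵣ Q))) (atomic_le_fixedOff N)
  have hS := cokernelSequence_shortExact i
  have hE : HigherLimsVanish E.presheaf :=
    higherLimsVanish_fixedOff_base ρ hM hG (hQ ▸ hp.one_lt)
  obtain ⟨e₁⟩ := nonempty_higherLim_succ_addEquiv hS hE n
  obtain ⟨g, σ, hσ, hσq⟩ := OrbitSpan.exists_conj T T' (diag : G × Q →* G ≀ᵣ Q)
    (MonoidHom.fst G Q) (fun x y h => Prod.ext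
      (congrFun (congrArg RegularWreathProduct.left h) 1)
      (congrArg RegularWreathProduct.right h)) Prod.fst_surjective (by
      rintro ⟨⟨a, c⟩, hx⟩
      obtain rfl : a = 1 := hx
      refine ⟨1, Subtype.ext (Prod.ext (one_pow _) ?_)⟩
      change c ^ p ^ 1 = 1
      rw [pow_one, ← hQ]
      exact pow_card_eq_one')
  have hq : ∀ x, σ.q x = x.1 := fun x => by rw [hσq]; rfl
  have hbot : ∀ x, x ∈ (σ.functor.obj (botObj _)).grp ↔ ∃ c, g⁻¹ * x * g = inl c := by
    intro x
    rw [σ.mem_functor_bot]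
    constructor
    · rintro ⟨⟨a, c⟩, hh, rfl⟩
      rw [hq] at hh
      obtain rfl : a = 1 := hh
      refine ⟨c, ?_⟩
      rw [hσ, diag_mk_one]
      simp [mul_assoc]
    · rintro ⟨c, hc⟩
      refine ⟨(1, c), hq _, ?_⟩
      rw [hσ, diag_mk_one, ← hc]
      simp [mul_assoc]
  have hF : ∀ P : OrbitCat (T : Subgroup (G ≀ᵣ Q)), Nontrivial ((cokernel i).obj (op P)) →
      ∃ g : G ≀ᵣ Q, ∀ x, x ∈ P.grp ↔ g⁻¹ * x * g ∈ (σ.functor.obj (botObj _)).grp := by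
    intro P hP
    have hP1 : P.grp ≠ ⊥ := by
      intro hbot
      refine @not_subsingleton _ hP (cokernel_subsingleton i fun m => ?_)
      refine ⟨(atomic _ _).elem (E.val P m)
        (mem_atomicObj.2 fun h => (h hbot).elim), E.val_injective P rfl⟩
    have hEP : Nontrivial (E.presheaf.obj (op P)) :=
      Function.Surjective.nontrivial (f := (cokernel.π i).app (op P)) (hS.app_surjective (op P))
    obtain ⟨m, hm⟩ := exists_ne (0 : E.presheaf.obj (op P))
    have h1 : ∀ x ∈ P.grp, x.right = 1 → x = 1 := by
      intro x hx hx1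
      by_contra hne
      refine hm (E.val_injective P ?_)
      rw [map_zero]
      exact (E.val_mem m).2 x hx (hN.2 hx1) hne
    -- As `Q` has prime order, a nontrivial `P` meeting the base group trivially projects onto `Q`,
    -- so it is a complement.
    have h2 : P.grp.map rightHom = ⊤ := by
      have : Fact (Nat.card Q).Prime := ⟨hQ.symm ▸ hp⟩
      refine ((P.grp.map (rightHom : G ≀ᵣ Q →* Q)).eq_bot_or_eq_top_of_prime_card).resolve_left
        fun h => hP1 ?_
      rw [Subgroup.eq_bot_iff_forall]
      intro x hx
      exact h1 x hx (Subgroup.mem_bot.1 (h ▸ Subgroup.mem_map_of_mem rightHom hx))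
    obtain ⟨a, ha⟩ := exists_conj_of_isComplement h1 fun c => by
      obtain ⟨x, hx, hxc⟩ : c ∈ P.grp.map rightHom := h2 ▸ Subgroup.mem_top c
      exact ⟨x, hx, hxc⟩
    refine ⟨a * g⁻¹, fun x => ?_⟩
    rw [ha, hbot]
    simp [mul_assoc]
  have hnorm : ∀ a : G ≀ᵣ Q, (∀ x ∈ (σ.functor.obj (botObj _)).grp,
      a⁻¹ * x * a ∈ (σ.functor.obj (botObj _)).grp) → ∃ h, σ.ι h = a := by
    intro a ha
    obtain ⟨x, hx⟩ := exists_diag_of_normalizes (v := g⁻¹ * a * g) fun c => by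
      obtain ⟨d, hd⟩ := (hbot _).1 (ha (g * inl c * g⁻¹) ((hbot _).2 ⟨c, by simp [mul_assoc]⟩))
      exact ⟨d, by rw [← hd]; simp [mul_assoc]⟩
    refine ⟨x, ?_⟩
    rw [hσ, hx]
    simp [mul_assoc]
  have hiso := σ.isIso_unit (cokernel i) hF hnorm T.2
  have e₂ := higherLimIso n
    (asIso (coindLift σ.functor (𝟙 ((presheafRes σ.functor).obj (cokernel i)))))
  obtain ⟨e₃⟩ := nonempty_higherLim_coind_iso (σ.homsAreCoproducts T.2) n
    ((presheafRes σ.functor).obj (cokernel i))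
  -- The conjugate of `Q` is nontrivial, so the atomic functor is zero there and the quotient has
  -- the same value as `E`.
  have hC : (σ.functor.obj (botObj (T' : Subgroup G))).grp ≠ ⊥ := by
    have : Nontrivial Q := Finite.one_lt_card_iff_nontrivial.1 (hQ ▸ hp.one_lt)
    obtain ⟨c, hc⟩ := exists_ne (1 : Q)
    intro h
    have h1 := (hbot (g * inl c * g⁻¹)).2 ⟨c, by simp [mul_assoc]⟩
    rw [h, Subgroup.mem_bot, conj_eq_one_iff] at h1
    exact hc (congrArg RegularWreathProduct.right h1)
  have hconst : ∀ w ∈ E.sub (σ.functor.obj (botObj (T' : Subgroup G))), ∀ c,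
      wreathRep Q ρ g⁻¹ w c = conjCoord ρ g w := by
    intro w hw c
    have h1 := hw.1 (g * inl c⁻¹ * g⁻¹) ((hbot _).2 ⟨c⁻¹, by simp [mul_assoc]⟩)
    conv_rhs => rw [← h1]
    rw [conjCoord_wreathRep_conj, wreathRep_inl, inv_inv, mul_one]
  let ε : E.presheaf.obj (op (σ.functor.obj (botObj (T' : Subgroup G)))) →+ M :=
    (conjCoord ρ g).comp (E.val _)
  -- Up to conjugation by `g`, vectors of `M^Q` fixed by `Q` are the constant ones, and a constant
  -- vector is its first coordinate.
  have hε : Function.Bijective ε := by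
    constructor
    · rw [injective_iff_map_eq_zero]
      intro w hw
      refine E.val_injective _ ?_
      have h1 : wreathRep Q ρ g⁻¹ (E.val _ w) = 0 :=
        funext fun c => (hconst _ (E.val_mem w) c).trans hw
      have h2 := congrArg (wreathRep Q ρ g) h1
      rw [← Module.End.mul_apply, ← map_mul, mul_inv_cancel, map_one, map_zero] at h2
      rw [map_zero]
      exact h2
    · intro m
      have hfix : ∀ c : Q, wreathRep Q ρ (inl c) (fun _ => m) = fun _ => m := fun c =>
        funext fun x => wreathRep_inl ρ c x _
      refine ⟨E.elem (wreathRep Q ρ g fun _ => m) ⟨fun x hx => ?_, fun x hx hxN hx1 => ?_⟩, ?_⟩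
      · obtain ⟨c, hc⟩ := (hbot x).1 hx
        have hx : x = g * inl c * g⁻¹ := by rw [← hc]; simp [mul_assoc]
        rw [← Module.End.mul_apply, ← map_mul, hx, inv_mul_cancel_right, map_mul,
          Module.End.mul_apply, hfix]
      · obtain ⟨c, hc⟩ := (hbot x).1 hx
        have h1 := congrArg RegularWreathProduct.right hc
        rw [mul_right, mul_right, hN.1 hxN, mul_one, inv_right, inv_mul_cancel, right_inl] at h1
        rw [← h1, map_one] at hc
        exact (hx1 (by simpa [mul_assoc, inv_mul_eq_one] using hc)).elim
      · have h := conjCoord_wreathRep ρ g g (fun _ => m)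
        rw [inv_mul_cancel, map_one] at h
        exact h
  have hπ := cokernel_bijective i
    (atomic_subsingleton (ρ := wreathRep Q ρ) hC)
  let e : (cokernel i).obj (op (σ.functor.obj (botObj (T' : Subgroup G)))) ≃+ M :=
    (AddEquiv.ofBijective ((cokernel.π i).app _).hom hπ).symm.trans (AddEquiv.ofBijective ε hε)
  have he : ∀ m, e ((cokernel.π i).app _ m) = ε m := by
    intro m
    exact congrArg ε ((AddEquiv.ofBijective ((cokernel.π i).app _).hom hπ).symm_apply_apply m)
  obtain ⟨e₄⟩ := nonempty_iso_atomicFunctor ρ ((presheafRes σ.functor).obj (cokernel i))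
    (fun c hc => by
      by_contra h
      rw [not_subsingleton_iff_nontrivial] at h
      refine hc ?_
      rw [σ.eq_bot_of_nontrivial (cokernel i) hF c h]
      rfl) e (by
    intro a m
    obtain ⟨y, rfl⟩ := hπ.surjective m
    have h1 := ConcreteCategory.congr_hom
      ((cokernel.π i).naturality (σ.functor.map (botHom (botObj _) a)).op) y
    refine (congrArg e h1.symm).trans ?_
    refine (he _).trans ?_
    rw [he]
    refine (congrArg (conjCoord ρ g)
      (E.val_map_functor_botHom σ (hq (a, 1)) y)).trans ?_
    rw [hσ, conjCoord_wreathRep_conj, wreathRep_diag]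
    · rfl
    · exact fun c => hconst _ (E.val_mem y) c)
  exact ⟨e₁.trans ((e₂ ≪≫ e₃ ≪≫ higherLimIso n e₄).addCommGroupIsoToAddEquiv)⟩

end WreathReduction

/-! ### Limits in degree zero and invariants -/

section DegreeZero

open OrbitCat Opposite FixedFamily

variable {k : Type*} [Semiring k] {G : Type u} [Group G] {M : Type u} [AddCommGroup M]
  [Module k M] {ρ : Representation k G M} {S : Subgroup G}

/-- A compatible family is determined by its component at the trivial subgroup, where compatibility
with automorphisms makes it invariant under the whole group. -/
theorem FixedFamily.isZero_higherLim_zero (A : FixedFamily ρ S)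
    (h : ∀ m, (∀ a, ρ a m = m) → m = 0) : IsZero (higherLim 0 A.presheaf) := by
  rw [isZero_higherLim_iff]
  refine (Abelian.Ext.addEquiv₀ (X := constInt _) (Y := A.presheaf)).toEquiv.subsingleton_congr.2 ?_
  refine subsingleton_of_forall_eq 0 fun f => ?_
  have key : ∀ {P Q : OrbitCat S} (a : G) (ha : ∀ x ∈ P.grp, a⁻¹ * x * a ∈ Q.grp) n,
      A.val P (f.app (op P) n) = ρ a (A.val Q (f.app (op Q) n)) := by
    intro P Q a ha n
    refine Eq.trans ?_ (A.val_map_homMk a ha _)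
    exact congrArg (A.val P) (ConcreteCategory.congr_hom (f.naturality (homMk a ha).op) n)
  have h0 : ∀ n, A.val (botObj S) (f.app _ n) = 0 := fun n =>
    h _ fun a => (key a (fun x hx => by
      rw [Subgroup.mem_bot.1 hx]
      simp [(botObj S).grp.one_mem]) n).symm
  ext P n
  refine A.val_injective P.unop ?_
  have h1 := key (P := botObj S) (Q := P.unop) 1 (fun x hx => by
    rw [Subgroup.mem_bot.1 hx]
    simp [P.unop.grp.one_mem]) n
  rw [h0, map_one] at h1
  exact h1.symm.trans (map_zero _).symm

end DegreeZero

/-! ### The natural module of the symmetric group -/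

section NaturalModules

open OrbitCat Opposite FixedFamily

theorem mem_diagonalSubmodule {p : ℕ} {x : Fin (p + 1) → ZMod p} :
    x ∈ diagonalSubmodule p ↔ ∃ a, ∀ i, x i = a := by
  rw [Submodule.mem_span_singleton]
  constructor
  · rintro ⟨a, rfl⟩
    exact ⟨a, fun i => mul_one a⟩
  · rintro ⟨a, ha⟩
    exact ⟨a, funext fun i => (mul_one a).trans (ha i).symm⟩

theorem naturalRep_mk_eq_iff {p : ℕ} (g : Equiv.Perm (Fin (p + 1))) (x : Fin (p + 1) → ZMod p) :
    naturalRep p g (Submodule.Quotient.mk x) = Submodule.Quotient.mk x ↔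
      ∃ a, ∀ i, x (g⁻¹ i) - x i = a := by
  change (Submodule.Quotient.mk (permRep (ZMod p) _ g x) : NaturalModule p) = _ ↔ _
  rw [Submodule.Quotient.eq, mem_diagonalSubmodule]
  rfl

variable {p : ℕ} [Fact p.Prime]

/-- A transposition of `0` and `i` changes a representative by a constant. As `p + 1 ≥ 3` there is
an unmoved point, where the change is zero, so the values at `0` and `i` agree. -/
theorem naturalRep_eq_zero_of_fixed (v : NaturalModule p) (hv : ∀ g, naturalRep p g v = v) :
    v = 0 := by
  obtain ⟨x, rfl⟩ := Submodule.Quotient.mk_surjective _ v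
  refine (Submodule.Quotient.mk_eq_zero _).2 (mem_diagonalSubmodule.2 ⟨x 0, fun i => ?_⟩)
  obtain ⟨j, hj⟩ : ∃ j : Fin (p + 1), j ∉ ({0, i} : Finset (Fin (p + 1))) := by
    by_contra! h
    have h1 : Finset.univ ⊆ ({0, i} : Finset (Fin (p + 1))) := fun j _ => h j
    have h2 := (Finset.card_le_card h1).trans Finset.card_le_two
    rw [Finset.card_univ, Fintype.card_fin] at h2
    have := (Fact.out : p.Prime).two_le
    omega
  simp only [Finset.mem_insert, Finset.mem_singleton, not_or] at hj
  obtain ⟨a, ha⟩ := (naturalRep_mk_eq_iff _ x).1 (hv (Equiv.swap 0 i))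
  have h1 := ha j
  have h2 := ha 0
  rw [Equiv.swap_inv, Equiv.swap_apply_of_ne_of_ne hj.1 hj.2, sub_self] at h1
  rw [Equiv.swap_inv, Equiv.swap_apply_left, ← h1] at h2
  exact sub_eq_zero.1 h2

/-- The orbit of a moved point has `p`-power size greater than one, so it fills the `p` points other
than `o`. -/
theorem IsPGroup.exists_apply_eq {P : Subgroup (Equiv.Perm (Fin (p + 1)))} (hP : IsPGroup p P)
    (hP1 : P ≠ ⊥) {o : Fin (p + 1)} (ho : ∀ g ∈ P, g o = o) {i j : Fin (p + 1)} (hi : i ≠ o)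
    (hj : j ≠ o) : ∃ g ∈ P, g i = j := by
  obtain ⟨⟨g, hg⟩, hg1⟩ := Subgroup.ne_bot_iff_exists_ne_one.1 hP1
  obtain ⟨l, hl⟩ : ∃ l, g l ≠ l := by
    by_contra! h
    exact hg1 (Subtype.ext (Equiv.ext h))
  have hlo : l ≠ o := fun h => hl (by rw [h, ho g hg])
  have hsub : MulAction.orbit P l ⊆ {o}ᶜ := by
    rintro _ ⟨h, rfl⟩ heq
    have heq : h.1 l = o := heq
    exact hlo (h.1.injective (heq.trans (ho _ h.2).symm))
  have hcard : p ≤ (MulAction.orbit P l).ncard := by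
    obtain ⟨n, hn⟩ := hP.card_orbit l
    rw [← Nat.card_coe_set_eq, hn]
    refine Nat.le_self_pow (fun h0 => hl ?_) p
    rw [h0, pow_zero, Nat.card_coe_set_eq, Set.ncard_eq_one] at hn
    obtain ⟨l', hl'⟩ := hn
    have h1 : g l ∈ MulAction.orbit P l := ⟨⟨g, hg⟩, rfl⟩
    have h2 := MulAction.mem_orbit_self (M := P) l
    rw [hl'] at h1 h2
    exact h1.trans h2.symm
  have heq : MulAction.orbit P l = {o}ᶜ := by
    refine Set.eq_of_subset_of_ncard_le hsub ?_ (Set.toFinite _)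
    rw [Set.ncard_compl, Set.ncard_singleton, Nat.card_eq_fintype_card, Fintype.card_fin]
    simpa using hcard
  obtain ⟨a, ha⟩ : i ∈ MulAction.orbit P l := heq ▸ hi
  obtain ⟨b, hb⟩ : j ∈ MulAction.orbit P l := heq ▸ hj
  refine ⟨b.1 * a.1⁻¹, mul_mem b.2 (inv_mem a.2), ?_⟩
  have ha : a.1 l = i := ha
  have hb : b.1 l = j := hb
  rw [Equiv.Perm.mul_apply, ← ha, ← hb]
  exact congrArg b.1 (a.1.symm_apply_apply l)

theorem IsPGroup.eq_of_fixed {P : Subgroup (Equiv.Perm (Fin (p + 1)))} (hP : IsPGroup p P)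
    (hP1 : P ≠ ⊥) {o : Fin (p + 1)} (ho : ∀ g ∈ P, g o = o) {i : Fin (p + 1)}
    (hi : ∀ g ∈ P, g i = i) : i = o := by
  by_contra hio
  refine hP1 ((Subgroup.eq_bot_iff_forall _).2 fun g hg => Equiv.ext fun j => ?_)
  by_cases hj : j = o
  · rw [hj, ho g hg, Equiv.Perm.one_apply]
  · obtain ⟨h, hh, rfl⟩ := hP.exists_apply_eq hP1 ho hio hj
    rw [hi h hh, hi g hg, Equiv.Perm.one_apply]

theorem naturalRep_mk_eq_self {p : ℕ} {a : Equiv.Perm (Fin (p + 1))} {o : Fin (p + 1)}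
    (ha : a o = o) {x : Fin (p + 1) → ZMod p} (hx : ∀ i j, i ≠ o → j ≠ o → x i = x j) :
    naturalRep p a (Submodule.Quotient.mk x) = Submodule.Quotient.mk x := by
  have ha' : a⁻¹ o = o := Equiv.Perm.inv_eq_iff_eq.2 ha.symm
  refine (naturalRep_mk_eq_iff _ _).2 ⟨0, fun i => sub_eq_zero.2 ?_⟩
  by_cases hi : i = o
  · rw [hi, ha']
  · exact hx _ _ (fun h => hi (a⁻¹.injective (h.trans ha'.symm))) hi

/-- Fixing a class in the quotient allows a constant change of representative; evaluating at the
fixed point `o` shows that the constant is zero. Transitivity on the remaining points does the rest.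
-/
theorem IsPGroup.fixed_iff {P : Subgroup (Equiv.Perm (Fin (p + 1)))} (hP : IsPGroup p P)
    (hP1 : P ≠ ⊥) {o : Fin (p + 1)} (ho : ∀ g ∈ P, g o = o) (x : Fin (p + 1) → ZMod p) :
    (∀ g ∈ P, naturalRep p g (Submodule.Quotient.mk x) = Submodule.Quotient.mk x) ↔
      ∀ i j, i ≠ o → j ≠ o → x i = x j := by
  constructor
  · intro h i j hi hj
    obtain ⟨g, hg, rfl⟩ := hP.exists_apply_eq hP1 ho hi hj
    obtain ⟨a, ha⟩ := (naturalRep_mk_eq_iff _ x).1 (h g hg)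
    have h1 := ha o
    have h2 := ha (g i)
    rw [ho _ (inv_mem hg), sub_self] at h1
    rw [show g⁻¹ (g i) = i from g.symm_apply_apply i, ← h1] at h2
    exact sub_eq_zero.1 h2
  · exact fun h g hg => naturalRep_mk_eq_self (ho g hg) h

/-- The first group `Λ` of the natural module of the symmetric group on `p + 1` letters. -/
theorem nonempty_Lambda_one_naturalRep (T : Sylow p (Equiv.Perm (Fin (p + 1)))) :
    Nonempty (Lambda (naturalRep p) T 1 ≃+ ZMod p) := by
  have hp : p.Prime := Fact.out
  -- For the trivial normal subgroup this is the full fixed-point functor; transfer handles positive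
  -- degrees, and degree zero is `V^G = 0`.
  let E := fixedOff (naturalRep p) (T : Subgroup (Equiv.Perm (Fin (p + 1)))) ⊥
  have hE : HigherLimsVanish E.presheaf := by
    rintro (_ | n)
    · exact E.isZero_higherLim_zero naturalRep_eq_zero_of_fixed
    · refine isZero_higherLim_succ_fixedOff (fun m => ?_) (fun x hx => ?_) n
      · rw [← Nat.cast_smul_eq_nsmul (ZMod p), CharP.cast_eq_zero, zero_smul]
      · rw [Subgroup.mem_bot.1 hx, map_one]
  let i := incl (ρ := naturalRep p) (S := (T : Subgroup (Equiv.Perm (Fin (p + 1)))))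
    (atomic_le_fixedOff ⊥)
  have hS := cokernelSequence_shortExact i
  obtain ⟨e₁⟩ := nonempty_higherLim_succ_addEquiv hS hE 0
  have hT : (T : Subgroup (Equiv.Perm (Fin (p + 1)))) ≠ ⊥ := by
    refine T.ne_bot_of_dvd_card ?_
    rw [Nat.card_eq_fintype_card, Fintype.card_perm, Fintype.card_fin]
    exact Nat.dvd_factorial hp.pos (Nat.le_succ p)
  -- A fixed point of `T` exists because `p + 1` is not divisible by `p`.
  obtain ⟨o, ho⟩ : ∃ o : Fin (p + 1), ∀ g ∈ T, g o = o := by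
    obtain ⟨o, ho⟩ := T.2.nonempty_fixed_point_of_prime_not_dvd_card (Fin (p + 1)) (by
      rw [Nat.card_eq_fintype_card, Fintype.card_fin, Nat.dvd_add_right dvd_rfl]
      exact hp.one_lt.ne' ∘ Nat.dvd_one.1)
    exact ⟨o, fun g hg => ho ⟨g, hg⟩⟩
  let t : OrbitCat (T : Subgroup (Equiv.Perm (Fin (p + 1)))) := ⟨_, le_rfl⟩
  have ht : ∀ c : OrbitCat (T : Subgroup (Equiv.Perm (Fin (p + 1)))), Nonempty (c ⟶ t) := fun c =>
    ⟨homMk 1 fun x hx => by simpa using c.le hx⟩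
  have hfix : ∀ (c : OrbitCat (T : Subgroup (Equiv.Perm (Fin (p + 1))))) (φ : c ⟶ t),
      c.grp ≠ ⊥ → ∀ m, E.val c (E.presheaf.map φ.op m) = E.val t m := by
    intro c φ hc m
    obtain ⟨a, ha, rfl⟩ := exists_eq_homMk φ
    refine (E.val_map_homMk a ha m).trans ?_
    -- Both `o` and `a o` are fixed by the nontrivial group `c`, which has only one fixed point.
    -- Hence `a` acts trivially on `V^T`, and all morphisms `c ⟶ t` induce the same map.
    have hao : a o = o := by
      refine (T.2.to_le c.le).eq_of_fixed hc (fun g hg => ho g (c.le hg)) fun g hg => ?_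
      have h1 : (a⁻¹ * g * a) o = o := ho _ (ha g hg)
      exact (Equiv.Perm.inv_eq_iff_eq).1 h1 |>.symm ▸ rfl
    obtain ⟨x, hx⟩ := Submodule.Quotient.mk_surjective _ (E.val t m)
    rw [← hx]
    refine naturalRep_mk_eq_self hao ((T.2.fixed_iff hT ho x).1 fun g hg => ?_)
    rw [hx]
    exact (E.val_mem m).1 g hg
  obtain ⟨e₂⟩ := nonempty_higherLim_zero_addEquiv ht (cokernel i) (by
    intro c φ ψ
    by_cases hc : c.grp = ⊥
    · have : Subsingleton ((cokernel i).obj (op c)) := cokernel_subsingleton i fun m =>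
        ⟨(atomic _ _).elem (E.val c m) (mem_atomicObj.2 fun h => (h hc).elim),
          E.val_injective c rfl⟩
      ext y
      exact this.elim _ _
    · ext y
      obtain ⟨m, rfl⟩ := hS.app_surjective _ y
      have h1 : ∀ φ : c ⟶ t, (cokernel i).map φ.op ((cokernel.π i).app _ m) =
          (cokernel.π i).app _ (E.presheaf.map φ.op m) := fun φ =>
        (ConcreteCategory.congr_hom ((cokernel.π i).naturality φ.op) m).symm
      refine (h1 φ).trans (Eq.trans ?_ (h1 ψ).symm)
      refine congrArg _ (E.val_injective c ?_)
      exact (hfix c φ hc m).trans (hfix c ψ hc m).symm)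
  have hπ := cokernel_bijective i (atomic_subsingleton (ρ := naturalRep p) (c := t) hT)
  obtain ⟨j, hj⟩ : ∃ j, j ≠ o := exists_ne o
  -- An element of `V^T` is constant away from `o`, so modulo constants it is measured by its jump
  -- at `o`.
  let δ : NaturalModule p →+ ZMod p := (Submodule.liftQ _
    (LinearMap.proj (R := ZMod p) (φ := fun _ => ZMod p) o - LinearMap.proj j) (by
      intro x hx
      obtain ⟨a, ha⟩ := mem_diagonalSubmodule.1 hx
      simp [ha])).toAddMonoidHom
  have hδ : ∀ x, δ (Submodule.Quotient.mk x) = x o - x j := fun x => rfl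
  let ε : E.presheaf.obj (op t) →+ ZMod p := δ.comp (E.val t)
  have hε : Function.Bijective ε := by
    constructor
    · rw [injective_iff_map_eq_zero]
      intro m hm
      refine E.val_injective t ?_
      obtain ⟨x, hx⟩ := Submodule.Quotient.mk_surjective _ (E.val t m)
      have hm : δ (E.val t m) = 0 := hm
      have h1 := (T.2.fixed_iff hT ho x).1 fun g hg => by
        rw [hx]
        exact (E.val_mem m).1 g hg
      rw [← hx, hδ] at hm
      rw [← hx, map_zero, Submodule.Quotient.mk_eq_zero, mem_diagonalSubmodule]
      refine ⟨x j, fun l => ?_⟩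
      by_cases hl : l = o
      · rw [hl]
        exact sub_eq_zero.1 hm
      · exact h1 l j hl hj
    · intro a
      refine ⟨E.elem (Submodule.Quotient.mk (Pi.single o a)) ⟨?_, fun x _ hx hx1 =>
        (hx1 (Subgroup.mem_bot.1 hx)).elim⟩, ?_⟩
      · refine (T.2.fixed_iff hT ho _).2 fun l l' hl hl' => ?_
        rw [Pi.single_eq_of_ne hl, Pi.single_eq_of_ne hl']
      · refine (hδ _).trans ?_
        rw [Pi.single_eq_same, Pi.single_eq_of_ne hj, sub_zero]
  exact ⟨e₁.trans (e₂.trans ((AddEquiv.ofBijective ((cokernel.π i).app _).hom hπ).symm.trans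
    (AddEquiv.ofBijective ε hε)))⟩

end NaturalModules

/-! ### Two degree shifts down to the base case -/

theorem mainTheorem4 (p : ℕ) [Fact p.Prime]
    (T : Sylow p ((Equiv.Perm (Fin (p + 1)) ≀ᵣ Cyc p) ≀ᵣ Cyc p)) :
    Nonempty (Lambda (wreathRep (Cyc p) (wreathRep (Cyc p) (naturalRep p))) T 3 ≃+ ZMod p) := by
  have hp : p.Prime := Fact.out
  have hQ : Nat.card (Cyc p) = p := Nat.card_zmod p
  have hG : p ∣ Nat.card (Equiv.Perm (Fin (p + 1))) := by
    rw [Nat.card_eq_fintype_card, Fintype.card_perm, Fintype.card_fin]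
    exact Nat.dvd_factorial hp.pos (Nat.le_succ p)
  have hM : ∀ m : NaturalModule p, p • m = 0 := fun m => by
    rw [← Nat.cast_smul_eq_nsmul (ZMod p), CharP.cast_eq_zero, zero_smul]
  have hG' : p ∣ Nat.card (Equiv.Perm (Fin (p + 1)) ≀ᵣ Cyc p) := by
    rw [RegularWreathProduct.card, hQ]
    exact dvd_mul_left _ _
  obtain ⟨T₀⟩ : Nonempty (Sylow p (Equiv.Perm (Fin (p + 1)))) := inferInstance
  obtain ⟨T₁⟩ : Nonempty (Sylow p (Equiv.Perm (Fin (p + 1)) ≀ᵣ Cyc p)) := inferInstance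
  obtain ⟨e₁⟩ := nonempty_Lambda_wreath (wreathRep (Cyc p) (naturalRep p))
    (fun m => funext fun x => hM (m x)) hG' hQ T T₁ 2
  obtain ⟨e₂⟩ := nonempty_Lambda_wreath (naturalRep p) hM hG hQ T₁ T₀ 1
  obtain ⟨e₃⟩ := nonempty_Lambda_one_naturalRep T₀
  exact ⟨e₁.trans (e₂.trans e₃)⟩
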